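/- Let $n_1,n_2\ge 2$ be integers, $\delta\in(0,2)$, $p\in(0,1/2)$, and let $\eta_1\in\{-1,1\}^{n_1}$, $\eta_2\in\{-1,1\}^{n_2}$ be arbitrary label vectors. Let $A$ be the $n_1\times n_2$ biadjacency matrix of the bipartite stochastic block model: the entries $A_{ij}$ are independent, with $A_{ij}\sim \mathrm{Ber}(\delta p)$ if $\eta_{1i}=\eta_{2j}$ and $A_{ij}\sim\mathrm{Ber}((2-\delta)p)$ if $\eta_{1i}\ne\eta_{2j}$. Let $W=A-\mathbb{E}(A)$, let $H(M)=M-\mathrm{diag}(M)$ for $M\in\mathbb{R}^{n_1\times n_1}$, where $\mathrm{diag}(M)$ is the diagonal matrix with the same diagonal as $M$, and let $\|\cdot\|_\infty$ denote the spectral norm. For every constant $C>0$ there exists a constant $c_*>0$, depending only on $C$ (and not on $n_1,n_2,\delta,p$ or the labels), such that if \[ p\ \ge\ C\left(\sqrt{\frac{\log n_1}{n_1n_2}}\ \vee\ \frac{\log n_1}{n_2}\right), \] then \[ \mathbb{E}\Big(\big\|H(WW^\top)\big\|_\infty^2\Big)\ \le\ c_*\left(1+\frac{n_1\log n_1}{n_2}\right)n_1n_2\,p^2\log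 n_1 . \] -/

import Mathlib

open MeasureTheory ProbabilityTheory

namespace BSBM

/-- Edge probability between a vertex with label `s` and a vertex with label `t`:
`δ p` if the labels agree and `(2 - δ) p` if they differ. -/
noncomputable def edgeProb (δ p : ℝ) (s t : ℤˣ) : ℝ :=
  if s = t then δ * p else (2 - δ) * p

/-- The random matrix `A` is a biadjacency matrix drawn from the bipartite stochastic block model
with parameters `δ`, `p` and with label vectors `η₁ ∈ {±1}^{n₁}`, `η₂ ∈ {±1}^{n₂}`: its entries
are jointly independent, and `A i j` takes the value `1` with probability
`edgeProb δ p (η₁ i) (η₂ j)` and the value `0` otherwise. -/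
structure IsBSBM {Ω : Type*} [MeasurableSpace Ω] (μ : Measure Ω) {n₁ n₂ : ℕ} (δ p : ℝ)
    (η₁ : Fin n₁ → ℤˣ) (η₂ : Fin n₂ → ℤˣ) (A : Ω → Matrix (Fin n₁) (Fin n₂) ℝ) : Prop where
  indep : iIndepFun (fun (ij : Fin n₁ × Fin n₂) ω => A ω ij.1 ij.2) μ
  law : ∀ i j, ∃ q : unitInterval, (q : ℝ) = edgeProb δ p (η₁ i) (η₂ j) ∧
    HasLaw (fun ω => A ω i j) (bernoulliMeasure (1 : ℝ) 0 q) μ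

/-- The noise matrix `W = A - 𝔼 A` (entrywise expectation). -/
noncomputable def noise {Ω : Type*} [MeasurableSpace Ω] (μ : Measure Ω) {n₁ n₂ : ℕ}
    (A : Ω → Matrix (Fin n₁) (Fin n₂) ℝ) (ω : Ω) : Matrix (Fin n₁) (Fin n₂) ℝ :=
  A ω - Matrix.of fun i j => ∫ ω', A ω' i j ∂μ

/-- The hollowing operator `H(M) = M - diag(M)`. -/
def hollow {n : ℕ} (M : Matrix (Fin n) (Fin n) ℝ) : Matrix (Fin n) (Fin n) ℝ :=
  M - Matrix.diagonal M.diag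

/-- The spectral norm of a real square matrix: its operator norm for the Euclidean norm. -/
noncomputable def specNorm {n : ℕ} (M : Matrix (Fin n) (Fin n) ℝ) : ℝ :=
  ‖Matrix.toEuclideanCLM (n := Fin n) (𝕜 := ℝ) M‖

end BSBM

/-! Write G = W Wᵀ, L = log n₁, and let t = 2p bound all edge probabilities.

Decoupling: H(G) is 4 times the average, over a uniformly random I, of the block of G with rows in I
and columns outside I, so it suffices to bound the second moment of one block. Given the rows of W
outside I, the rows of this block are independent, with covariance at most t‖PGP‖, where P is the
coordinate projection off I.

The engine is a Rosenthal-type trace inequality, `pexp_trace_gramSum_pow_le`. With S = ∑ vᵢvᵢᵀ,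
expand tr S^(m+1) = ∑ vᵢ·Sᵐvᵢ, remove vᵢvᵢᵀ from S at the price of a factor e and a term
(m+1)ᵐ|vᵢ|^(2m+2), average over vᵢ, and absorb half of the trace. With m+1 = ⌈L⌉ the dimension costs
only a constant factor, and `bexp_crossPart_sq_le` gives E‖block‖² ≲ n₁p E‖PGP‖ + L B, where B
controls the moments of the row norms.

Since ‖PGP‖ ≤ ‖H(G)‖ + ‖diag G‖, the estimate is self-bounding (`bexp_hollow_sq_le`): X = E‖H(G)‖²
satisfies X ≲ n₁p(√X + D) + L B, where D ≲ n₂p bounds the mean largest diagonal entry. Hence X ≲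
(n₁p)² + n₁n₂p² + L B.

Finally B ≲ n₁n₂p² (`bexp_row_pow_le_pow`) follows from the same Rosenthal inequality in dimension
one and exponential moments of the entries of G. The condition p ≳ L/n₂ controls the diagonal
entries, and p ≳ √(L/(n₁n₂)) the off-diagonal ones. -/

namespace BSBM

/-! ### Expectations over finite product spaces. -/

section ProductExpectation

variable {ι R : Type*} [Fintype ι] [Fintype R] [DecidableEq ι]

/-- The expectation of `f` when the coordinates are independent and coordinate `i` has the
weights `π i`. -/
noncomputable def pexp (π : ι → R → ℝ) (f : (ι → R) → ℝ) : ℝ :=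
  ∑ a, (∏ i, π i (a i)) * f a

lemma pexp_mono {π : ι → R → ℝ} (hπ : ∀ i b, 0 ≤ π i b) {f g : (ι → R) → ℝ}
    (h : ∀ a, f a ≤ g a) : pexp π f ≤ pexp π g :=
  Finset.sum_le_sum fun a _ =>
    mul_le_mul_of_nonneg_left (h a) (Finset.prod_nonneg fun i _ => hπ i _)

lemma pexp_nonneg {π : ι → R → ℝ} (hπ : ∀ i b, 0 ≤ π i b) {f : (ι → R) → ℝ}
    (h : ∀ a, 0 ≤ f a) : 0 ≤ pexp π f :=
  Finset.sum_nonneg fun a _ =>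
    mul_nonneg (Finset.prod_nonneg fun i _ => hπ i _) (h a)

lemma pexp_add (π : ι → R → ℝ) (f g : (ι → R) → ℝ) :
    pexp π (fun a => f a + g a) = pexp π f + pexp π g := by
  simp [pexp, mul_add, Finset.sum_add_distrib]

lemma pexp_const_mul (π : ι → R → ℝ) (c : ℝ) (f : (ι → R) → ℝ) :
    pexp π (fun a => c * f a) = c * pexp π f := by
  simp only [pexp, Finset.mul_sum]
  exact Finset.sum_congr rfl fun a _ => by ring

lemma pexp_sum {κ : Type*} (π : ι → R → ℝ) (s : Finset κ) (f : κ → (ι → R) → ℝ) :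
    pexp π (fun a => ∑ k ∈ s, f k a) = ∑ k ∈ s, pexp π (f k) := by
  simp only [pexp, Finset.mul_sum]
  exact Finset.sum_comm

lemma pexp_prod (π : ι → R → ℝ) (g : ι → R → ℝ) :
    pexp π (fun a => ∏ i, g i (a i)) = ∏ i, ∑ b, π i b * g i b := by
  rw [Finset.prod_univ_sum, Fintype.piFinset_univ]
  exact Finset.sum_congr rfl fun a _ => by rw [Finset.prod_mul_distrib]

lemma pexp_const {π : ι → R → ℝ} (hπ : ∀ i, ∑ b, π i b = 1) (c : ℝ) :
    pexp π (fun _ => c) = c := by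
  have h := pexp_prod π (fun _ _ => 1)
  simp only [Finset.prod_const_one, mul_one, hπ] at h
  have h2 := pexp_const_mul π c (fun _ => 1)
  simp only [mul_one, h] at h2
  exact h2

/-- Resampling one coordinate does not change the expectation. -/
lemma pexp_resample {π : ι → R → ℝ} (hπ : ∀ i, ∑ b, π i b = 1) (i : ι) (f : (ι → R) → ℝ) :
    pexp π f = pexp π (fun a => ∑ b, π i b * f (Function.update a i b)) := by
  classical
  have key : ∀ a : ι → R, ∏ j, π j (a j) = π i (a i) * ∏ j ∈ Finset.univ.erase i, π j (a j) :=
    fun a => (Finset.mul_prod_erase _ _ (Finset.mem_univ i)).symm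
  have hupd : ∀ (a : ι → R) (b : R), ∏ j ∈ Finset.univ.erase i, π j (Function.update a i b j)
      = ∏ j ∈ Finset.univ.erase i, π j (a j) := fun a b =>
    Finset.prod_congr rfl fun j hj => by
      rw [Function.update_of_ne (Finset.ne_of_mem_erase hj)]
  -- the map `(a, b) ↦ (update a i b, a i)` is an involution
  let e : (ι → R) × R ≃ (ι → R) × R :=
    { toFun := fun x => (Function.update x.1 i x.2, x.1 i)
      invFun := fun x => (Function.update x.1 i x.2, x.1 i)
      left_inv := fun x => by simp
      right_inv := fun x => by simp }
  calc pexp π f = ∑ a : ι → R, ∑ b : R, (∏ j, π j (a j)) * π i b * f a := by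
        refine Finset.sum_congr rfl fun a _ => ?_
        rw [← Finset.sum_mul, ← Finset.mul_sum, hπ, mul_one]
    _ = ∑ x : (ι → R) × R, (∏ j, π j (x.1 j)) * π i x.2 * f x.1 := by
        rw [Fintype.sum_prod_type]
    _ = ∑ x : (ι → R) × R, (∏ j, π j ((e x).1 j)) * π i (e x).2 * f (e x).1 :=
        (Equiv.sum_comp e _).symm
    _ = ∑ x : (ι → R) × R, (∏ j, π j (x.1 j)) * (π i x.2 * f (Function.update x.1 i x.2)) := by
        refine Finset.sum_congr rfl fun x _ => ?_
        simp only [e, Equiv.coe_fn_mk, key, hupd, Function.update_self]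
        ring
    _ = _ := by
        rw [Fintype.sum_prod_type]
        exact Finset.sum_congr rfl fun a _ => by rw [Finset.mul_sum]

lemma pexp_marginal {π : ι → R → ℝ} (hπ : ∀ i, ∑ b, π i b = 1) (i : ι) (g : R → ℝ) :
    pexp π (fun a => g (a i)) = ∑ b, π i b * g b := by
  rw [pexp_resample hπ i]
  simp only [Function.update_self]
  exact pexp_const hπ _

end ProductExpectation

/-! ### Powers of a positive semidefinite matrix under a rank-one perturbation. -/

section RankOne

open Matrix

variable {n : Type*} [Fintype n] [DecidableEq n]

lemma exists_spectral {S : Matrix n n ℝ} (hS : S.PosSemidef) :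
    ∃ (l : n → ℝ) (u : n → n → ℝ), (∀ i, 0 ≤ l i) ∧ (∀ i, u i ⬝ᵥ u i = 1) ∧
      (∀ (k : ℕ) (v : n → ℝ), v ⬝ᵥ (S ^ k *ᵥ v) = ∑ i, l i ^ k * (u i ⬝ᵥ v) ^ 2) ∧
      ∀ k : ℕ, (S ^ k).trace = ∑ i, l i ^ k := by
  set O : Matrix n n ℝ := (hS.1.eigenvectorUnitary : Matrix n n ℝ) with hO
  set l := hS.1.eigenvalues with hl
  have hOO : Oᵀ * O = 1 := by
    have := (Matrix.mem_unitaryGroup_iff' (A := O)).1 hS.1.eigenvectorUnitary.2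
    rwa [Matrix.star_eq_conjTranspose, Matrix.conjTranspose_eq_transpose_of_trivial] at this
  have hOO' : O * Oᵀ = 1 := mul_eq_one_comm.1 hOO
  have hSp : S = O * diagonal l * Oᵀ := by
    have := hS.1.spectral_theorem
    rw [Unitary.conjStarAlgAut_apply] at this
    rw [← Matrix.conjTranspose_eq_transpose_of_trivial, ← Matrix.star_eq_conjTranspose]
    simpa using this
  have hpow : ∀ k : ℕ, S ^ k = O * diagonal (fun i => l i ^ k) * Oᵀ := by
    intro k
    induction k with
    | zero => simp [hOO']
    | succ k ih =>
      rw [pow_succ, ih]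
      conv_lhs => rw [hSp]
      calc O * diagonal (fun i => l i ^ k) * Oᵀ * (O * diagonal l * Oᵀ)
          = O * diagonal (fun i => l i ^ k) * (Oᵀ * O) * diagonal l * Oᵀ := by
            simp only [Matrix.mul_assoc]
        _ = _ := by
            rw [hOO, Matrix.mul_one, Matrix.mul_assoc O, diagonal_mul_diagonal]
            simp only [pow_succ]
  refine ⟨l, fun i => Oᵀ i, hS.eigenvalues_nonneg, fun i => ?_, fun k v => ?_, fun k => ?_⟩
  · have := congrFun (congrFun hOO i) i
    simpa [Matrix.mul_apply, dotProduct] using this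
  · rw [hpow, ← Matrix.mulVec_mulVec, ← Matrix.mulVec_mulVec, Matrix.dotProduct_mulVec,
      ← Matrix.mulVec_transpose]
    simp only [dotProduct, Matrix.mulVec_diagonal]
    simp only [dotProduct, Matrix.mulVec]
    exact Finset.sum_congr rfl fun i _ => by ring
  · rw [hpow, Matrix.trace_mul_cycle, hOO, Matrix.one_mul, Matrix.trace_diagonal]

/-- `v ⬝ Sᵐ (S + v vᵀ)ʲ v` satisfies a two-term recursion. -/
lemma dotProduct_pow_rankOne_succ (S : Matrix n n ℝ) (v : n → ℝ) (m j : ℕ) :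
    v ⬝ᵥ ((S ^ m * (S + vecMulVec v v) ^ (j + 1)) *ᵥ v)
      = v ⬝ᵥ ((S ^ (m + 1) * (S + vecMulVec v v) ^ j) *ᵥ v)
        + (v ⬝ᵥ (S ^ m *ᵥ v)) * (v ⬝ᵥ ((S + vecMulVec v v) ^ j *ᵥ v)) := by
  rw [pow_succ' (S + vecMulVec v v) j, pow_succ S m, Matrix.add_mul, Matrix.mul_add,
    Matrix.add_mulVec, dotProduct_add, Matrix.mul_assoc]
  congr 1
  rw [← Matrix.mulVec_mulVec, ← Matrix.mulVec_mulVec, Matrix.vecMulVec_mulVec,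
    Matrix.mulVec_smul, dotProduct_smul]
  simp

lemma dotProduct_pow_rankOne_nonneg {S : Matrix n n ℝ} (hS : S.PosSemidef) (v : n → ℝ)
    (j : ℕ) : ∀ m : ℕ, 0 ≤ v ⬝ᵥ ((S ^ m * (S + vecMulVec v v) ^ j) *ᵥ v) := by
  induction j with
  | zero =>
    intro m
    simpa using (hS.pow m).dotProduct_mulVec_nonneg v
  | succ j ih =>
    intro m
    rw [dotProduct_pow_rankOne_succ]
    have h0 := ih 0
    rw [pow_zero, Matrix.one_mul] at h0
    have h1 : 0 ≤ v ⬝ᵥ (S ^ m *ᵥ v) := by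
      simpa using (hS.pow m).dotProduct_mulVec_nonneg v
    exact add_nonneg (ih _) (mul_nonneg h1 h0)

/-- The bound is what one would get if S acted on v as the scalar x, since v vᵀ acts on v as v·v.
The recursion has nonnegative terms, so bounds on the moments v·Sᵏv propagate through it. -/
lemma dotProduct_pow_rankOne_le {S : Matrix n n ℝ} (hS : S.PosSemidef) (v : n → ℝ) {x : ℝ}
    (hx : 0 ≤ x) {M : ℕ} (h : ∀ k ≤ M, v ⬝ᵥ (S ^ k *ᵥ v) ≤ (v ⬝ᵥ v) * x ^ k) (j : ℕ) :
    ∀ m : ℕ, m + j ≤ M → v ⬝ᵥ ((S ^ m * (S + vecMulVec v v) ^ j) *ᵥ v)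
      ≤ (v ⬝ᵥ v) * x ^ m * (x + v ⬝ᵥ v) ^ j := by
  have hr : 0 ≤ v ⬝ᵥ v := by simpa using dotProduct_star_self_nonneg v
  induction j with
  | zero =>
    intro m hm
    simpa using h m (by omega)
  | succ j ih =>
    intro m hm
    rw [dotProduct_pow_rankOne_succ]
    have h0 := ih 0 (by omega)
    rw [pow_zero, Matrix.one_mul, pow_zero, mul_one] at h0
    have hb : 0 ≤ v ⬝ᵥ ((S + vecMulVec v v) ^ j *ᵥ v) := by
      simpa using dotProduct_pow_rankOne_nonneg hS v j 0
    calc _ ≤ (v ⬝ᵥ v) * x ^ (m + 1) * (x + v ⬝ᵥ v) ^ j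
            + ((v ⬝ᵥ v) * x ^ m) * ((v ⬝ᵥ v) * (x + v ⬝ᵥ v) ^ j) := by
          refine add_le_add (ih _ (by omega)) (mul_le_mul (h m (by omega)) h0 hb (by positivity))
      _ = _ := by ring

/-- Replacing the factors S by S + v vᵀ one at a time adds a nonnegative term v·Sᵐ(S + v vᵀ)ʲv at
each replacement. -/
lemma trace_pow_le_trace_pow_rankOne {S : Matrix n n ℝ} (hS : S.PosSemidef) (v : n → ℝ)
    (k : ℕ) : (S ^ k).trace ≤ ((S + vecMulVec v v) ^ k).trace := by
  have key : ∀ j m : ℕ, (S ^ (m + j)).trace ≤ (S ^ m * (S + vecMulVec v v) ^ j).trace := by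
    intro j
    induction j with
    | zero => intro m; simp
    | succ j ih =>
      intro m
      have h1 := ih (m + 1)
      have h2 : (S ^ m * (S + vecMulVec v v) ^ (j + 1)).trace
          = (S ^ (m + 1) * (S + vecMulVec v v) ^ j).trace
            + v ⬝ᵥ (((S + vecMulVec v v) ^ j * S ^ m) *ᵥ v) := by
        rw [pow_succ' (S + vecMulVec v v) j, pow_succ S m, Matrix.add_mul, Matrix.mul_add,
          Matrix.trace_add, Matrix.mul_assoc]
        congr 1
        rw [← Matrix.mul_assoc, Matrix.trace_mul_comm, ← Matrix.mul_assoc, Matrix.mul_vecMulVec,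
          Matrix.trace_vecMulVec, dotProduct_comm]
      have h3 : v ⬝ᵥ (((S + vecMulVec v v) ^ j * S ^ m) *ᵥ v)
          = v ⬝ᵥ ((S ^ m * (S + vecMulVec v v) ^ j) *ᵥ v) := by
        have hT : Sᵀ = S := by
          simpa [Matrix.conjTranspose_eq_transpose_of_trivial] using hS.1.eq
        have hV : (vecMulVec v v)ᵀ = vecMulVec v v := by
          rw [Matrix.transpose_vecMulVec]
        rw [Matrix.dotProduct_mulVec, ← Matrix.mulVec_transpose, dotProduct_comm,
          Matrix.transpose_mul, Matrix.transpose_pow, Matrix.transpose_pow,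
          Matrix.transpose_add, hT, hV]
      rw [h2, h3]
      have := dotProduct_pow_rankOne_nonneg hS v j m
      have e : m + (j + 1) = m + 1 + j := by ring
      rw [e]
      linarith
  simpa using key k 0

/-- The numbers (v·Sᵏv)/(v·v) are the moments of the spectral measure of S at v, a probability
measure. Taking x to be its Lᵐ norm, Jensen's inequality controls the lower moments. -/
lemma dotProduct_pow_le_of_moment {S : Matrix n n ℝ} (hS : S.PosSemidef) (v : n → ℝ) {m : ℕ}
    (hm : m ≠ 0) : ∃ x : ℝ, 0 ≤ x ∧ (v ⬝ᵥ v) * x ^ m = v ⬝ᵥ (S ^ m *ᵥ v) ∧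
      ∀ k ≤ m, v ⬝ᵥ (S ^ k *ᵥ v) ≤ (v ⬝ᵥ v) * x ^ k := by
  obtain ⟨l, u, hl, -, hq, -⟩ := exists_spectral hS
  have hr : 0 ≤ v ⬝ᵥ v := by simpa using dotProduct_star_self_nonneg v
  rcases hr.eq_or_lt with h0 | hpos
  · have hv : v = 0 := dotProduct_self_eq_zero.1 h0.symm
    exact ⟨0, le_rfl, by simp [hv], fun k _ => by simp [hv]⟩
  set r := v ⬝ᵥ v with hrdef
  have hsum : ∑ i, (u i ⬝ᵥ v) ^ 2 / r = 1 := by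
    have := hq 0 v
    simp only [pow_zero, Matrix.one_mulVec, one_mul] at this
    rw [← Finset.sum_div, ← this]
    exact div_self hpos.ne'
  have ham : 0 ≤ v ⬝ᵥ (S ^ m *ᵥ v) := by
    simpa using (hS.pow m).dotProduct_mulVec_nonneg v
  set y := v ⬝ᵥ (S ^ m *ᵥ v) / r with hy
  have hy0 : 0 ≤ y := div_nonneg ham hr
  have hxm : (y ^ ((m : ℝ)⁻¹)) ^ m = y := Real.rpow_inv_natCast_pow hy0 hm
  refine ⟨y ^ ((m : ℝ)⁻¹), by positivity, ?_, fun k hk => ?_⟩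
  · rw [hxm, hy]; field_simp
  rcases Nat.eq_zero_or_pos k with rfl | hk0
  · simp [← hrdef]
  have hkR : (0 : ℝ) < k := by exact_mod_cast hk0
  have hmR : (0 : ℝ) < m := by exact_mod_cast Nat.pos_of_ne_zero hm
  have J := Real.rpow_arith_mean_le_arith_mean_rpow Finset.univ
    (fun i => (u i ⬝ᵥ v) ^ 2 / r) (fun i => l i ^ k) (fun i _ => by positivity) hsum
    (fun i _ => pow_nonneg (hl i) k) (p := (m : ℝ) / k)
    (by rw [le_div_iff₀ hkR]; simpa using (by exact_mod_cast hk : (k : ℝ) ≤ m))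
  have e1 : ∑ i, (u i ⬝ᵥ v) ^ 2 / r * l i ^ k = v ⬝ᵥ (S ^ k *ᵥ v) / r := by
    rw [hq k v, Finset.sum_div]
    exact Finset.sum_congr rfl fun i _ => by ring
  have e2 : ∑ i, (u i ⬝ᵥ v) ^ 2 / r * (l i ^ k) ^ ((m : ℝ) / k) = y := by
    rw [hy, hq m v, Finset.sum_div]
    refine Finset.sum_congr rfl fun i _ => ?_
    have : (l i ^ k) ^ ((m : ℝ) / k) = l i ^ m := by
      rw [← Real.rpow_natCast, ← Real.rpow_mul (hl i), mul_div_cancel₀ _ hkR.ne',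
        Real.rpow_natCast]
    rw [this]; ring
  rw [e1, e2] at J
  have hak : 0 ≤ v ⬝ᵥ (S ^ k *ᵥ v) / r :=
    div_nonneg (by simpa using (hS.pow k).dotProduct_mulVec_nonneg v) hr
  have h2 : v ⬝ᵥ (S ^ k *ᵥ v) / r ≤ (y ^ ((m : ℝ)⁻¹)) ^ k := by
    have := Real.rpow_le_rpow (by positivity) J (z := (k : ℝ) / m) (by positivity)
    rw [← Real.rpow_mul hak, div_mul_div_cancel₀ hkR.ne', div_self hmR.ne', Real.rpow_one] at this
    refine this.trans_eq ?_
    rw [← Real.rpow_natCast, ← Real.rpow_mul hy0]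
    congr 1
    field_simp
  rw [div_le_iff₀ hpos] at h2
  linarith

/-- Either r ≤ x/m, and (1 + 1/m)ᵐ ≤ e, or x ≤ m r. The leading factor thus stays bounded in m; only
the power of r carries a growing constant. -/
lemma add_pow_le_exp_one_mul {x r : ℝ} (hx : 0 ≤ x) (hr : 0 ≤ r) (m : ℕ) :
    (x + r) ^ m ≤ Real.exp 1 * x ^ m + (m + 1 : ℝ) ^ m * r ^ m := by
  rcases Nat.eq_zero_or_pos m with rfl | hm
  · have := Real.exp_pos 1
    simp; linarith
  have hmR : (0 : ℝ) < m := by exact_mod_cast hm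
  rcases le_total (m * r) x with h | h
  · have h1 : x + r ≤ x * (1 + 1 / m) := by
      have : r ≤ x / m := by rw [le_div_iff₀ hmR]; linarith
      calc x + r ≤ x + x / m := by linarith
        _ = _ := by ring
    have h2 : (1 + 1 / (m : ℝ)) ^ m ≤ Real.exp 1 := by
      calc (1 + 1 / (m : ℝ)) ^ m ≤ (Real.exp (1 / m)) ^ m := by
            gcongr
            have := Real.add_one_le_exp (1 / (m : ℝ))
            linarith
        _ = Real.exp 1 := by
            rw [← Real.exp_nat_mul]; congr 1; field_simp
    calc (x + r) ^ m ≤ (x * (1 + 1 / m)) ^ m := by gcongr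
      _ = (1 + 1 / (m : ℝ)) ^ m * x ^ m := by rw [mul_pow]; ring
      _ ≤ Real.exp 1 * x ^ m := by gcongr
      _ ≤ _ := by
        have : 0 ≤ (m + 1 : ℝ) ^ m * r ^ m := by positivity
        linarith
  · calc (x + r) ^ m ≤ ((m + 1 : ℝ) * r) ^ m := by
          gcongr
          linarith
      _ = (m + 1 : ℝ) ^ m * r ^ m := mul_pow _ _ _
      _ ≤ _ := by
        have : 0 ≤ Real.exp 1 * x ^ m := by positivity
        linarith

lemma dotProduct_rankOne_pow_le {S : Matrix n n ℝ} (hS : S.PosSemidef) (v : n → ℝ) (m : ℕ) :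
    v ⬝ᵥ ((S + vecMulVec v v) ^ m *ᵥ v) ≤
      Real.exp 1 * (v ⬝ᵥ (S ^ m *ᵥ v)) + (m + 1 : ℝ) ^ m * (v ⬝ᵥ v) ^ (m + 1) := by
  have hr : 0 ≤ v ⬝ᵥ v := by simpa using dotProduct_star_self_nonneg v
  rcases Nat.eq_zero_or_pos m with rfl | hm
  · have := Real.exp_pos 1
    simp; positivity
  obtain ⟨x, hx, hxm, hk⟩ := dotProduct_pow_le_of_moment hS v hm.ne'
  have h := dotProduct_pow_rankOne_le hS v hx hk m 0 (by omega)
  rw [pow_zero, Matrix.one_mul, pow_zero, mul_one] at h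
  refine h.trans ?_
  rw [← hxm]
  calc (v ⬝ᵥ v) * (x + v ⬝ᵥ v) ^ m
      ≤ (v ⬝ᵥ v) * (Real.exp 1 * x ^ m + (m + 1 : ℝ) ^ m * (v ⬝ᵥ v) ^ m) := by
        gcongr
        exact add_pow_le_exp_one_mul hx hr m
    _ = _ := by ring

end RankOne

end BSBM

namespace BSBM

/-! ### A Rosenthal inequality for traces of powers of random Gram sums. -/

section Moment

open Matrix

variable {ι R n : Type*} [Fintype ι] [Fintype R] [DecidableEq ι] [Fintype n] [DecidableEq n]

/-- The sum over `i ∈ I` of the rank-one matrices `vᵢ vᵢᵀ`. -/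
def gramSum (I : Finset ι) (v : ι → n → ℝ) : Matrix n n ℝ :=
  ∑ i ∈ I, vecMulVec (v i) (v i)

lemma gramSum_posSemidef (I : Finset ι) (v : ι → n → ℝ) : (gramSum I v).PosSemidef := by
  refine Matrix.posSemidef_sum I fun i _ => ?_
  simpa using Matrix.posSemidef_vecMulVec_self_star (v i)

lemma gramSum_eq_erase_add {I : Finset ι} {i : ι} (hi : i ∈ I) (v : ι → n → ℝ) :
    gramSum I v = gramSum (I.erase i) v + vecMulVec (v i) (v i) :=
  (Finset.sum_erase_add I _ hi).symm

lemma trace_gramSum_pow_succ (I : Finset ι) (v : ι → n → ℝ) (m : ℕ) :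
    (gramSum I v ^ (m + 1)).trace = ∑ i ∈ I, v i ⬝ᵥ (gramSum I v ^ m *ᵥ v i) := by
  rw [pow_succ]
  conv_lhs => rw [show gramSum I v ^ m * gramSum I v
    = gramSum I v ^ m * ∑ i ∈ I, vecMulVec (v i) (v i) from rfl]
  rw [Matrix.mul_sum, Matrix.trace_sum]
  exact Finset.sum_congr rfl fun i _ => by
    rw [Matrix.mul_vecMulVec, Matrix.trace_vecMulVec, dotProduct_comm]

lemma mul_pow_le_half_add {A l : ℝ} (hA : 0 ≤ A) (hl : 0 ≤ l) (m : ℕ) :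
    A * l ^ m ≤ 1 / 2 * l ^ (m + 1) + 1 / 2 * (2 * A) ^ (m + 1) := by
  rcases le_total (2 * A) l with h | h
  · have h1 : A * l ^ m ≤ 1 / 2 * l * l ^ m := by gcongr; linarith
    have h2 : 0 ≤ 1 / 2 * (2 * A) ^ (m + 1) := by positivity
    calc A * l ^ m ≤ 1 / 2 * l * l ^ m := h1
      _ = 1 / 2 * l ^ (m + 1) := by ring
      _ ≤ _ := by linarith
  · have h1 : A * l ^ m ≤ A * (2 * A) ^ m := by gcongr
    have h2 : 0 ≤ 1 / 2 * l ^ (m + 1) := by positivity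
    calc A * l ^ m ≤ A * (2 * A) ^ m := h1
      _ = 1 / 2 * (2 * A) ^ (m + 1) := by ring
      _ ≤ _ := by linarith

/-- Applied eigenvalue by eigenvalue, the scalar inequality trades a lower power for half of the
higher one, which can then be absorbed on the left-hand side. -/
lemma mul_trace_pow_le {S : Matrix n n ℝ} (hS : S.PosSemidef) {A : ℝ} (hA : 0 ≤ A) (m : ℕ) :
    A * (S ^ m).trace ≤
      1 / 2 * (S ^ (m + 1)).trace + 1 / 2 * ((2 * A) ^ (m + 1) * Fintype.card n) := by
  obtain ⟨l, u, hl, -, -, ht⟩ := exists_spectral hS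
  rw [ht, ht, Finset.mul_sum, Finset.mul_sum]
  calc _ ≤ ∑ i, (1 / 2 * l i ^ (m + 1) + 1 / 2 * (2 * A) ^ (m + 1)) :=
        Finset.sum_le_sum fun i _ => mul_pow_le_half_add hA (hl i) m
    _ = _ := by
        rw [Finset.sum_add_distrib, Finset.sum_const, Finset.card_univ, nsmul_eq_mul]
        ring

/-- Averaging a quadratic form of `Sᵐ` over a vector whose covariance is at most `N`. -/
lemma sum_dotProduct_pow_le {S : Matrix n n ℝ} (hS : S.PosSemidef) {w : R → ℝ} {y : R → n → ℝ}
    {N : ℝ} (hcov : ∀ u : n → ℝ, ∑ b, w b * (u ⬝ᵥ y b) ^ 2 ≤ N * (u ⬝ᵥ u)) (m : ℕ) :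
    ∑ b, w b * (y b ⬝ᵥ (S ^ m *ᵥ y b)) ≤ N * (S ^ m).trace := by
  obtain ⟨l, u, hl, hu, hq, ht⟩ := exists_spectral hS
  calc ∑ b, w b * (y b ⬝ᵥ (S ^ m *ᵥ y b))
      = ∑ i, l i ^ m * ∑ b, w b * (u i ⬝ᵥ y b) ^ 2 := by
        simp only [hq, Finset.mul_sum]
        rw [Finset.sum_comm]
        exact Finset.sum_congr rfl fun i _ => Finset.sum_congr rfl fun b _ => by ring
    _ ≤ ∑ i, l i ^ m * N := by
        refine Finset.sum_le_sum fun i _ => mul_le_mul_of_nonneg_left ?_ (pow_nonneg (hl i) m)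
        simpa [hu i] using hcov (u i)
    _ = _ := by rw [ht, ← Finset.sum_mul, mul_comm]

/-- A Rosenthal-type inequality for sums of independent random rank-one matrices. -/
theorem pexp_trace_gramSum_pow_le {π : ι → R → ℝ} (hπ0 : ∀ i b, 0 ≤ π i b)
    (hπ1 : ∀ i, ∑ b, π i b = 1) (I : Finset ι) (v : (ι → R) → ι → n → ℝ) (g N : (ι → R) → ℝ)
    (hg : ∀ a, 0 ≤ g a) (hN : ∀ a, 0 ≤ N a)
    (hgI : ∀ i ∈ I, ∀ a b, g (Function.update a i b) = g a)
    (hv : ∀ i ∈ I, ∀ k ∈ I, k ≠ i → ∀ a b, v (Function.update a i b) k = v a k)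
    (hcov : ∀ i ∈ I, ∀ (a : ι → R) (u : n → ℝ),
      ∑ b, π i b * (u ⬝ᵥ v (Function.update a i b) i) ^ 2 ≤ N a * (u ⬝ᵥ u)) (m : ℕ) :
    pexp π (fun a => g a * (gramSum I (v a) ^ (m + 1)).trace) ≤
      pexp π (fun a => g a * ((2 * (Real.exp 1 * I.card * N a)) ^ (m + 1) * Fintype.card n
        + 2 * (m + 1 : ℝ) ^ m * ∑ i ∈ I, (v a i ⬝ᵥ v a i) ^ (m + 1))) := by
  set X := pexp π (fun a => g a * (gramSum I (v a) ^ (m + 1)).trace) with hX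
  set Y := pexp π (fun a => g a * ((2 * (Real.exp 1 * I.card * N a)) ^ (m + 1)
    * Fintype.card n)) with hY
  set Z := pexp π (fun a => g a * ((m + 1 : ℝ) ^ m * ∑ i ∈ I, (v a i ⬝ᵥ v a i) ^ (m + 1))) with hZ
  -- Resampling coordinate i changes neither g nor the sum without vᵢ, so only the covariance of vᵢ
  -- enters; restoring vᵢvᵢᵀ afterwards can only increase the trace.
  have hterm : ∀ i ∈ I, pexp π (fun a => g a * (v a i ⬝ᵥ (gramSum (I.erase i) (v a) ^ m *ᵥ v a i)))
      ≤ pexp π (fun a => g a * (N a * (gramSum I (v a) ^ m).trace)) := by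
    intro i hi
    rw [pexp_resample hπ1 i]
    refine pexp_mono hπ0 fun a => ?_
    have hE : ∀ b, gramSum (I.erase i) (v (Function.update a i b)) = gramSum (I.erase i) (v a) :=
      fun b => Finset.sum_congr rfl fun k hk => by
        rw [hv i hi k (Finset.mem_of_mem_erase hk) (Finset.ne_of_mem_erase hk)]
    calc _ = g a * ∑ b, π i b * (v (Function.update a i b) i ⬝ᵥ
            (gramSum (I.erase i) (v a) ^ m *ᵥ v (Function.update a i b) i)) := by
          rw [Finset.mul_sum]
          refine Finset.sum_congr rfl fun b _ => ?_
          rw [hgI i hi, hE]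
          ring
      _ ≤ g a * (N a * (gramSum (I.erase i) (v a) ^ m).trace) :=
          mul_le_mul_of_nonneg_left
            (sum_dotProduct_pow_le (gramSum_posSemidef _ _) (hcov i hi a) m) (hg a)
      _ ≤ _ := by
          refine mul_le_mul_of_nonneg_left (mul_le_mul_of_nonneg_left ?_ (hN a)) (hg a)
          rw [gramSum_eq_erase_add hi (v a)]
          exact trace_pow_le_trace_pow_rankOne (gramSum_posSemidef _ _) _ m
  have h1 : X ≤ Real.exp 1 *
      (∑ i ∈ I, pexp π (fun a => g a * (v a i ⬝ᵥ (gramSum (I.erase i) (v a) ^ m *ᵥ v a i)))) + Z := by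
    rw [← pexp_sum, ← pexp_const_mul, hZ, ← pexp_add]
    refine pexp_mono hπ0 fun a => ?_
    rw [trace_gramSum_pow_succ, ← Finset.mul_sum, Finset.mul_sum I _ ((m + 1 : ℝ) ^ m),
      mul_left_comm, ← mul_add]
    refine mul_le_mul_of_nonneg_left ?_ (hg a)
    rw [Finset.mul_sum, ← Finset.sum_add_distrib]
    refine Finset.sum_le_sum fun i hi => ?_
    conv_lhs => rw [gramSum_eq_erase_add hi (v a)]
    exact dotProduct_rankOne_pow_le (gramSum_posSemidef _ _) _ m
  -- The half of X produced here is absorbed at the end, which doubles the two remaining terms.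
  have h2 : Real.exp 1 *
      (∑ i ∈ I, pexp π (fun a => g a * (v a i ⬝ᵥ (gramSum (I.erase i) (v a) ^ m *ᵥ v a i))))
      ≤ 1 / 2 * X + 1 / 2 * Y := by
    calc _ ≤ Real.exp 1 * ∑ i ∈ I, pexp π (fun a => g a * (N a * (gramSum I (v a) ^ m).trace)) :=
          mul_le_mul_of_nonneg_left (Finset.sum_le_sum hterm) (Real.exp_pos 1).le
      _ = pexp π (fun a => Real.exp 1 * I.card * (g a * (N a * (gramSum I (v a) ^ m).trace))) := by
          rw [Finset.sum_const, nsmul_eq_mul, ← mul_assoc, pexp_const_mul]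
      _ ≤ _ := by
          rw [hX, hY, ← pexp_const_mul, ← pexp_const_mul, ← pexp_add]
          refine pexp_mono hπ0 fun a => ?_
          have := mul_le_mul_of_nonneg_left (mul_trace_pow_le (gramSum_posSemidef I (v a))
            (A := Real.exp 1 * I.card * N a)
            (mul_nonneg (by positivity) (hN a)) m) (hg a)
          linarith
  have h3 : pexp π (fun a => g a * ((2 * (Real.exp 1 * I.card * N a)) ^ (m + 1) * Fintype.card n
        + 2 * (m + 1 : ℝ) ^ m * ∑ i ∈ I, (v a i ⬝ᵥ v a i) ^ (m + 1))) = Y + 2 * Z := by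
    rw [hY, hZ, ← pexp_const_mul, ← pexp_add]
    congr 1
    funext a
    ring
  rw [h3]
  linarith

end Moment

end BSBM

namespace BSBM

/-! ### Moment generating functions of centred Bernoulli variables. -/

section Entries

/-- The weights of the Bernoulli distribution with parameter `r`. -/
def bern (r : ℝ) (b : Bool) : ℝ := if b then r else 1 - r

/-- A centred Bernoulli value. -/
def ctr (r : ℝ) (b : Bool) : ℝ := (if b then 1 else 0) - r

lemma sum_bern (r : ℝ) : ∑ b, bern r b = 1 := by simp [bern]

lemma bern_nonneg {r : ℝ} (h0 : 0 ≤ r) (h1 : r ≤ 1) (b : Bool) : 0 ≤ bern r b := by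
  cases b <;> simp [bern, h0, h1]

lemma sum_bern_mul_ctr (r : ℝ) : ∑ b, bern r b * ctr r b = 0 := by
  simp [bern, ctr]; ring

lemma sum_bern_mul_ctr_sq (r : ℝ) : ∑ b, bern r b * ctr r b ^ 2 = r * (1 - r) := by
  simp [bern, ctr]; ring

lemma sum_bern_mul_ctr_sq_le {r : ℝ} (h0 : 0 ≤ r) : ∑ b, bern r b * ctr r b ^ 2 ≤ r := by
  rw [sum_bern_mul_ctr_sq]; nlinarith

lemma abs_ctr_le_one {r : ℝ} (h0 : 0 ≤ r) (h1 : r ≤ 1) (b : Bool) : |ctr r b| ≤ 1 := by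
  cases b <;> simp [ctr, abs_le] <;> constructor <;> linarith

lemma ctr_sq_le_one {r : ℝ} (h0 : 0 ≤ r) (h1 : r ≤ 1) (b : Bool) : ctr r b ^ 2 ≤ 1 :=
  (sq_le_one_iff_abs_le_one _).2 (abs_ctr_le_one h0 h1 b)

lemma exp_mul_le_one_add {s y : ℝ} (hy0 : 0 ≤ y) (hy1 : y ≤ 1) :
    Real.exp (s * y) ≤ 1 + y * (Real.exp s - 1) := by
  have h := convexOn_exp.2 (Set.mem_univ (0 : ℝ)) (Set.mem_univ s) (sub_nonneg.2 hy1) hy0 (by ring)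
  simp only [smul_eq_mul, mul_zero, zero_add, Real.exp_zero, mul_one] at h
  rw [mul_comm s y]
  linarith

lemma exp_le_one_add_add_sq (y : ℝ) : Real.exp y ≤ 1 + y + y ^ 2 * Real.exp |y| := by
  have h := Complex.norm_exp_sub_sum_le_norm_mul_exp (y : ℂ) 2
  have e : Complex.exp (y : ℂ) - ∑ m ∈ Finset.range 2, (y : ℂ) ^ m / (m.factorial : ℂ)
      = ((Real.exp y - (1 + y) : ℝ) : ℂ) := by
    simp [Finset.sum_range_succ]
  rw [e, Complex.norm_real, Complex.norm_real, Real.norm_eq_abs, Real.norm_eq_abs, sq_abs] at h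
  have := le_abs_self (Real.exp y - (1 + y))
  linarith

lemma sum_bern_exp_ctr_sq_le {r s : ℝ} (h0 : 0 ≤ r) (h1 : r ≤ 1) (hs : 0 ≤ s) :
    ∑ b, bern r b * Real.exp (s * ctr r b ^ 2) ≤ Real.exp (r * (Real.exp s - 1)) := by
  have hs1 : 0 ≤ Real.exp s - 1 := by linarith [Real.add_one_le_exp s]
  calc _ ≤ ∑ b, bern r b * (1 + ctr r b ^ 2 * (Real.exp s - 1)) :=
        Finset.sum_le_sum fun b _ => mul_le_mul_of_nonneg_left
          (exp_mul_le_one_add (sq_nonneg _) (ctr_sq_le_one h0 h1 b)) (bern_nonneg h0 h1 b)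
    _ = 1 + (∑ b, bern r b * ctr r b ^ 2) * (Real.exp s - 1) := by
        simp only [mul_add, mul_one, Finset.sum_add_distrib, sum_bern, Finset.sum_mul, mul_assoc]
    _ ≤ 1 + r * (Real.exp s - 1) := by
        gcongr
        exact sum_bern_mul_ctr_sq_le h0
    _ ≤ _ := by linarith [Real.add_one_le_exp (r * (Real.exp s - 1))]

/-- The linear term vanishes by centring, so the exponent is of order r r' rather than r. This gain
is what makes off-diagonal entries of W Wᵀ smaller than diagonal ones. -/
lemma sum_bern_exp_mul_ctr_le {r r' t : ℝ} (h0 : 0 ≤ r) (h1 : r ≤ 1) (h0' : 0 ≤ r')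
    (h1' : r' ≤ 1) :
    ∑ b, bern r b * ∑ b', bern r' b' * Real.exp (t * (ctr r b * ctr r' b')) ≤
      Real.exp (r * r' * (t ^ 2 * Real.exp |t|)) := by
  have hpt : ∀ b b', Real.exp (t * (ctr r b * ctr r' b')) ≤
      1 + t * ctr r b * ctr r' b' + t ^ 2 * Real.exp |t| * ctr r b ^ 2 * ctr r' b' ^ 2 := by
    intro b b'
    refine (exp_le_one_add_add_sq _).trans ?_
    have h2 : |t * (ctr r b * ctr r' b')| ≤ |t| := by
      rw [abs_mul, abs_mul]
      have := mul_le_one₀ (abs_ctr_le_one h0 h1 b) (abs_nonneg _) (abs_ctr_le_one h0' h1' b')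
      nlinarith [abs_nonneg t]
    have h3 : (t * (ctr r b * ctr r' b')) ^ 2 * Real.exp |t * (ctr r b * ctr r' b')|
        ≤ (t * (ctr r b * ctr r' b')) ^ 2 * Real.exp |t| := by gcongr
    calc _ ≤ 1 + t * (ctr r b * ctr r' b') + (t * (ctr r b * ctr r' b')) ^ 2 * Real.exp |t| := by
          linarith
      _ = _ := by ring
  calc _ ≤ ∑ b, bern r b * ∑ b', bern r' b' * (1 + t * ctr r b * ctr r' b' +
        t ^ 2 * Real.exp |t| * ctr r b ^ 2 * ctr r' b' ^ 2) := by
        refine Finset.sum_le_sum fun b _ => mul_le_mul_of_nonneg_left ?_ (bern_nonneg h0 h1 b)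
        exact Finset.sum_le_sum fun b' _ =>
          mul_le_mul_of_nonneg_left (hpt b b') (bern_nonneg h0' h1' b')
    _ = 1 + t ^ 2 * Real.exp |t| * ((∑ b, bern r b * ctr r b ^ 2) *
          ∑ b', bern r' b' * ctr r' b' ^ 2) := by
        simp [bern, ctr]; ring
    _ ≤ 1 + t ^ 2 * Real.exp |t| * (r * r') := by
        have e0 : 0 ≤ ∑ b', bern r' b' * ctr r' b' ^ 2 := by
          rw [sum_bern_mul_ctr_sq]; exact mul_nonneg h0' (by linarith)
        have := mul_le_mul (sum_bern_mul_ctr_sq_le h0) (sum_bern_mul_ctr_sq_le h0') e0 h0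
        gcongr
    _ ≤ _ := by
        have := Real.add_one_le_exp (r * r' * (t ^ 2 * Real.exp |t|))
        linarith

/-- Converts exponential moments into polynomial ones, with s left free for optimisation. -/
lemma pow_le_pow_mul_exp {y s : ℝ} (hs : 0 < s) (hy : 0 ≤ y) {q : ℕ} (hq : q ≠ 0) :
    y ^ q ≤ (q / s) ^ q * Real.exp (s * y) := by
  have hqR : (0 : ℝ) < q := by exact_mod_cast Nat.pos_of_ne_zero hq
  have h1 : y ≤ q / s * Real.exp (s * y / q) := by
    have h := Real.add_one_le_exp (s * y / q)
    calc y = q / s * (s * y / q) := by field_simp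
      _ ≤ _ := by gcongr; linarith
  calc y ^ q ≤ (q / s * Real.exp (s * y / q)) ^ q := by gcongr
    _ = _ := by
        rw [mul_pow, ← Real.exp_nat_mul]
        congr 2
        field_simp

end Entries

/-! ### Covariance and exponential moments of independent Bernoulli rows. -/

section Rows

variable {κ : Type*} [Fintype κ] [DecidableEq κ]

/-- The weights of a row of independent Bernoulli entries. -/
noncomputable def rowWeight (r : κ → ℝ) (x : κ → Bool) : ℝ := ∏ j, bern (r j) (x j)

lemma sum_rowWeight_mul (r : κ → ℝ) (f : (κ → Bool) → ℝ) :
    ∑ x, rowWeight r x * f x = pexp (fun j => bern (r j)) f := rfl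

lemma sum_rowWeight (r : κ → ℝ) : ∑ x, rowWeight r x = 1 := by
  have := pexp_const (π := fun j => bern (r j)) (fun j => sum_bern (r j)) 1
  simpa [pexp, rowWeight] using this

lemma rowWeight_nonneg {r : κ → ℝ} (h0 : ∀ j, 0 ≤ r j) (h1 : ∀ j, r j ≤ 1) (x : κ → Bool) :
    0 ≤ rowWeight r x :=
  Finset.prod_nonneg fun j _ => bern_nonneg (h0 j) (h1 j) _

lemma sum_rowWeight_sq_le {r : κ → ℝ} {t : ℝ} (h0 : ∀ j, 0 ≤ r j) (ht : ∀ j, r j ≤ t)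
    (y : κ → ℝ) :
    ∑ x, rowWeight r x * (∑ j, ctr (r j) (x j) * y j) ^ 2 ≤ t * ∑ j, y j ^ 2 := by
  have hoff : ∀ j l, l ≠ j →
      pexp (fun j => bern (r j)) (fun x => ctr (r j) (x j) * y j * (ctr (r l) (x l) * y l)) = 0 := by
    intro j l hlj
    rw [pexp_resample (fun j => sum_bern (r j)) j]
    simp only [Function.update_self, Function.update_of_ne hlj]
    have : ∀ x : κ → Bool, ∑ b, bern (r j) b * (ctr (r j) b * y j * (ctr (r l) (x l) * y l)) = 0 := by
      intro x
      have h := sum_bern_mul_ctr (r j)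
      calc _ = (∑ b, bern (r j) b * ctr (r j) b) * (y j * (ctr (r l) (x l) * y l)) := by
            rw [Finset.sum_mul]
            exact Finset.sum_congr rfl fun b _ => by ring
        _ = 0 := by rw [h, zero_mul]
    simp only [this]
    exact pexp_const (fun j => sum_bern (r j)) 0
  have hdiag : ∀ j, pexp (fun j => bern (r j))
      (fun x => ctr (r j) (x j) * y j * (ctr (r j) (x j) * y j)) ≤ t * y j ^ 2 := by
    intro j
    rw [pexp_marginal (fun j => sum_bern (r j)) j
      (fun b => ctr (r j) b * y j * (ctr (r j) b * y j))]
    calc _ = (∑ b, bern (r j) b * ctr (r j) b ^ 2) * y j ^ 2 := by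
          rw [Finset.sum_mul]
          exact Finset.sum_congr rfl fun b _ => by ring
      _ ≤ _ := by
          gcongr
          exact (sum_bern_mul_ctr_sq_le (h0 j)).trans (ht j)
  rw [sum_rowWeight_mul]
  calc _ = ∑ j, ∑ l, pexp (fun j => bern (r j))
        (fun x => ctr (r j) (x j) * y j * (ctr (r l) (x l) * y l)) := by
        rw [← Finset.sum_congr rfl fun j _ => pexp_sum _ _ _, ← pexp_sum]
        congr 1
        funext x
        rw [sq, Finset.sum_mul_sum]
    _ = ∑ j, pexp (fun j => bern (r j))
        (fun x => ctr (r j) (x j) * y j * (ctr (r j) (x j) * y j)) :=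
        Finset.sum_congr rfl fun j _ =>
          Finset.sum_eq_single j (fun l _ hl => hoff j l hl) (fun h => absurd (Finset.mem_univ j) h)
    _ ≤ _ := by
        rw [Finset.mul_sum]
        exact Finset.sum_le_sum fun j _ => hdiag j

lemma sum_rowWeight_exp_sq_le {r : κ → ℝ} {t s : ℝ} (h0 : ∀ j, 0 ≤ r j) (h1 : ∀ j, r j ≤ 1)
    (ht : ∀ j, r j ≤ t) (hs : 0 ≤ s) :
    ∑ x, rowWeight r x * Real.exp (s * ∑ j, ctr (r j) (x j) ^ 2) ≤
      Real.exp (Fintype.card κ * (t * (Real.exp s - 1))) := by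
  have hs1 : 0 ≤ Real.exp s - 1 := by linarith [Real.add_one_le_exp s]
  rw [sum_rowWeight_mul]
  calc _ = ∏ j, ∑ b, bern (r j) b * Real.exp (s * ctr (r j) b ^ 2) := by
        rw [← pexp_prod]
        congr 1
        funext x
        rw [Finset.mul_sum, Real.exp_sum]
    _ ≤ ∏ _j : κ, Real.exp (t * (Real.exp s - 1)) := by
        refine Finset.prod_le_prod (fun j _ => Finset.sum_nonneg fun b _ =>
          mul_nonneg (bern_nonneg (h0 j) (h1 j) b) (Real.exp_pos _).le) fun j _ => ?_
        refine (sum_bern_exp_ctr_sq_le (h0 j) (h1 j) hs).trans ?_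
        gcongr
        exact ht j
    _ = _ := by
        rw [Finset.prod_const, Finset.card_univ, ← Real.exp_nat_mul]

lemma sum_rowWeight_exp_mul_le {r r' : κ → ℝ} {t s : ℝ} (h0 : ∀ j, 0 ≤ r j) (h1 : ∀ j, r j ≤ 1)
    (ht : ∀ j, r j ≤ t) (h0' : ∀ j, 0 ≤ r' j) (h1' : ∀ j, r' j ≤ 1) (ht' : ∀ j, r' j ≤ t) :
    ∑ x, rowWeight r x * ∑ x', rowWeight r' x' *
        Real.exp (s * ∑ j, ctr (r j) (x j) * ctr (r' j) (x' j)) ≤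
      Real.exp (Fintype.card κ * (t ^ 2 * (s ^ 2 * Real.exp |s|))) := by
  have hin : ∀ x : κ → Bool, ∑ x', rowWeight r' x' *
        Real.exp (s * ∑ j, ctr (r j) (x j) * ctr (r' j) (x' j))
      = ∏ j, ∑ b', bern (r' j) b' * Real.exp (s * (ctr (r j) (x j) * ctr (r' j) b')) := by
    intro x
    rw [sum_rowWeight_mul, ← pexp_prod]
    congr 1
    funext x'
    rw [Finset.mul_sum, Real.exp_sum]
  simp only [hin]
  rw [sum_rowWeight_mul, pexp_prod (fun j => bern (r j))
    (fun j b => ∑ b', bern (r' j) b' * Real.exp (s * (ctr (r j) b * ctr (r' j) b')))]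
  calc _ ≤ ∏ _j : κ, Real.exp (t ^ 2 * (s ^ 2 * Real.exp |s|)) := by
        refine Finset.prod_le_prod (fun j _ => Finset.sum_nonneg fun b _ =>
          mul_nonneg (bern_nonneg (h0 j) (h1 j) b) (Finset.sum_nonneg fun b' _ =>
            mul_nonneg (bern_nonneg (h0' j) (h1' j) b') (Real.exp_pos _).le)) fun j _ => ?_
        refine (sum_bern_exp_mul_ctr_le (h0 j) (h1 j) (h0' j) (h1' j)).trans ?_
        gcongr
        rw [sq]
        exact mul_le_mul (ht j) (ht' j) (h0' j) ((h0 j).trans (ht j))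
    _ = _ := by
        rw [Finset.prod_const, Finset.card_univ, ← Real.exp_nat_mul]

end Rows

end BSBM

namespace BSBM

/-! ### Entries and rows of W Wᵀ, with whole rows of W as the independent coordinates. -/

section Model

open Matrix

variable {ι κ : Type*} [Fintype ι] [Fintype κ] [DecidableEq ι] [DecidableEq κ]

/-- The centred matrix with Bernoulli parameters `ρ` and values `a`. -/
def ctrMat (ρ : ι → κ → ℝ) (a : ι → κ → Bool) : Matrix ι κ ℝ :=
  Matrix.of fun i j => ctr (ρ i j) (a i j)

/-- The expectation for independent Bernoulli entries with parameters `ρ`. -/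
noncomputable def bexp (ρ : ι → κ → ℝ) (f : (ι → κ → Bool) → ℝ) : ℝ :=
  pexp (fun i => rowWeight (ρ i)) f

lemma ctrMat_update_self (ρ : ι → κ → ℝ) (a : ι → κ → Bool) (i : ι) (x : κ → Bool) (j : κ) :
    ctrMat ρ (Function.update a i x) i j = ctr (ρ i j) (x j) := by
  simp [ctrMat]

lemma ctrMat_update_of_ne (ρ : ι → κ → ℝ) (a : ι → κ → Bool) {i k : ι} (h : k ≠ i)
    (x : κ → Bool) (j : κ) : ctrMat ρ (Function.update a i x) k j = ctrMat ρ a k j := by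
  simp [ctrMat, h]

/-- The inner product of two rows. -/
lemma mul_transpose_apply' (W : Matrix ι κ ℝ) (i k : ι) :
    (W * Wᵀ) i k = ∑ j, W i j * W k j := by
  simp [Matrix.mul_apply]

variable {ρ : ι → κ → ℝ} {t : ℝ}

lemma bexp_resample (i : ι) (f : (ι → κ → Bool) → ℝ) :
    bexp ρ f = bexp ρ (fun a => ∑ x, rowWeight (ρ i) x * f (Function.update a i x)) :=
  pexp_resample (fun i => sum_rowWeight (ρ i)) i f

lemma bexp_const (c : ℝ) : bexp ρ (fun _ => c) = c :=
  pexp_const (fun i => sum_rowWeight (ρ i)) c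

lemma bexp_mono (h0 : ∀ i j, 0 ≤ ρ i j) (h1 : ∀ i j, ρ i j ≤ 1) {f g : (ι → κ → Bool) → ℝ}
    (h : ∀ a, f a ≤ g a) : bexp ρ f ≤ bexp ρ g :=
  pexp_mono (fun i => rowWeight_nonneg (h0 i) (h1 i)) h

lemma bexp_exp_diag_le (h0 : ∀ i j, 0 ≤ ρ i j) (h1 : ∀ i j, ρ i j ≤ 1) (ht : ∀ i j, ρ i j ≤ t)
    {s : ℝ} (hs : 0 ≤ s) (i : ι) :
    bexp ρ (fun a => Real.exp (s * (ctrMat ρ a * (ctrMat ρ a)ᵀ) i i)) ≤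
      Real.exp (Fintype.card κ * (t * (Real.exp s - 1))) := by
  refine le_trans (le_of_eq ?_) (sum_rowWeight_exp_sq_le (h0 i) (h1 i) (ht i) hs)
  rw [← pexp_marginal (fun i => sum_rowWeight (ρ i)) i
    (fun x => Real.exp (s * ∑ j, ctr (ρ i j) (x j) ^ 2))]
  simp only [bexp, mul_transpose_apply', ctrMat, Matrix.of_apply, sq]

lemma bexp_exp_offDiag_le (h0 : ∀ i j, 0 ≤ ρ i j) (h1 : ∀ i j, ρ i j ≤ 1)
    (ht : ∀ i j, ρ i j ≤ t) (s : ℝ) {i k : ι} (hik : i ≠ k) :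
    bexp ρ (fun a => Real.exp (s * (ctrMat ρ a * (ctrMat ρ a)ᵀ) i k)) ≤
      Real.exp (Fintype.card κ * (t ^ 2 * (s ^ 2 * Real.exp |s|))) := by
  refine le_trans (le_of_eq ?_) (sum_rowWeight_exp_mul_le (s := s) (h0 i) (h1 i) (ht i)
    (h0 k) (h1 k) (ht k))
  rw [← pexp_marginal (fun i => sum_rowWeight (ρ i)) i
    (fun x => ∑ x', rowWeight (ρ k) x' *
      Real.exp (s * ∑ j, ctr (ρ i j) (x j) * ctr (ρ k j) (x' j))), bexp_resample k]
  simp only [mul_transpose_apply', ctrMat_update_self, ctrMat_update_of_ne ρ _ hik]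
  rfl

lemma mul_transpose_diag_nonneg (W : Matrix ι κ ℝ) (i : ι) : 0 ≤ (W * Wᵀ) i i := by
  rw [mul_transpose_apply']
  exact Finset.sum_nonneg fun j _ => mul_self_nonneg _

lemma bexp_diag_pow_le (h0 : ∀ i j, 0 ≤ ρ i j) (h1 : ∀ i j, ρ i j ≤ 1) (ht : ∀ i j, ρ i j ≤ t)
    {s : ℝ} (hs : 0 < s) (i : ι) {q : ℕ} (hq : q ≠ 0) :
    bexp ρ (fun a => ((ctrMat ρ a * (ctrMat ρ a)ᵀ) i i) ^ q) ≤
      (q / s) ^ q * Real.exp (Fintype.card κ * (t * (Real.exp s - 1))) := by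
  calc _ ≤ bexp ρ (fun a => (q / s) ^ q *
          Real.exp (s * (ctrMat ρ a * (ctrMat ρ a)ᵀ) i i)) :=
        bexp_mono h0 h1 fun a => pow_le_pow_mul_exp hs (mul_transpose_diag_nonneg _ i) hq
    _ = (q / s) ^ q * bexp ρ (fun a => Real.exp (s * (ctrMat ρ a * (ctrMat ρ a)ᵀ) i i)) :=
        pexp_const_mul _ _ _
    _ ≤ _ := by
        gcongr
        exact bexp_exp_diag_le h0 h1 ht hs.le i

lemma bexp_offDiag_pow_le (h0 : ∀ i j, 0 ≤ ρ i j) (h1 : ∀ i j, ρ i j ≤ 1)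
    (ht : ∀ i j, ρ i j ≤ t) {s : ℝ} (hs : 0 < s) {i k : ι} (hik : i ≠ k) {q : ℕ} (hq : q ≠ 0) :
    bexp ρ (fun a => (((ctrMat ρ a * (ctrMat ρ a)ᵀ) i k) ^ 2) ^ q) ≤
      ((2 * q / s) ^ 2) ^ q *
        (2 * Real.exp (Fintype.card κ * (t ^ 2 * (s ^ 2 * Real.exp s)))) := by
  have hpt : ∀ z : ℝ, (z ^ 2) ^ q ≤
      ((2 * q / s) ^ 2) ^ q * (Real.exp (s * z) + Real.exp (-s * z)) := by
    intro z
    have h := pow_le_pow_mul_exp hs (abs_nonneg z) (q := 2 * q) (by omega)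
    rw [pow_mul, sq_abs, pow_mul] at h
    push_cast at h
    refine h.trans ?_
    gcongr
    rcases abs_cases z with ⟨e, -⟩ | ⟨e, -⟩ <;> rw [e]
    · linarith [Real.exp_pos (-s * z)]
    · rw [mul_neg, ← neg_mul]; linarith [Real.exp_pos (s * z)]
  have hp := bexp_exp_offDiag_le h0 h1 ht s hik
  have hm := bexp_exp_offDiag_le h0 h1 ht (-s) hik
  rw [abs_of_pos hs] at hp
  rw [abs_neg, abs_of_pos hs, neg_sq] at hm
  calc _ ≤ bexp ρ (fun a => ((2 * q / s) ^ 2) ^ q *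
          (Real.exp (s * (ctrMat ρ a * (ctrMat ρ a)ᵀ) i k)
            + Real.exp (-s * (ctrMat ρ a * (ctrMat ρ a)ᵀ) i k))) :=
        bexp_mono h0 h1 fun a => hpt _
    _ = ((2 * q / s) ^ 2) ^ q *
          (bexp ρ (fun a => Real.exp (s * (ctrMat ρ a * (ctrMat ρ a)ᵀ) i k))
            + bexp ρ (fun a => Real.exp (-s * (ctrMat ρ a * (ctrMat ρ a)ᵀ) i k))) := by
        rw [bexp, pexp_const_mul, pexp_add]; rfl
    _ ≤ _ := by
        gcongr
        linarith

lemma dotProduct_unit (u v : Unit → ℝ) : u ⬝ᵥ v = u () * v () := by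
  simp [dotProduct]

/-- Turns the trace inequality in dimension one into a moment bound for a sum of squares. -/
lemma trace_gramSum_unit_pow (I : Finset ι) (z : ι → ℝ) (q : ℕ) :
    (gramSum I (fun k (_ : Unit) => z k) ^ q).trace = (∑ k ∈ I, z k ^ 2) ^ q := by
  have : gramSum I (fun k (_ : Unit) => z k) = Matrix.diagonal fun _ => ∑ k ∈ I, z k ^ 2 := by
    ext i j
    simp [gramSum, Matrix.sum_apply, Matrix.vecMulVec_apply, sq]
  rw [this, Matrix.diagonal_pow]
  simp

/-- Moments of the squared norm of a row of `W Wᵀ` restricted to columns in `K ∌ i`. -/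
lemma bexp_row_pow_le (h0 : ∀ i j, 0 ≤ ρ i j) (h1 : ∀ i j, ρ i j ≤ 1) (ht0 : 0 ≤ t)
    (ht : ∀ i j, ρ i j ≤ t) {i : ι} {K : Finset ι} (hi : i ∉ K) (m : ℕ) :
    bexp ρ (fun a => (∑ k ∈ K, ((ctrMat ρ a * (ctrMat ρ a)ᵀ) i k) ^ 2) ^ (m + 1)) ≤
      (2 * (Real.exp 1 * K.card * t)) ^ (m + 1) *
          bexp ρ (fun a => ((ctrMat ρ a * (ctrMat ρ a)ᵀ) i i) ^ (m + 1))
        + 2 * (m + 1 : ℝ) ^ m * ∑ k ∈ K,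
          bexp ρ (fun a => (((ctrMat ρ a * (ctrMat ρ a)ᵀ) i k) ^ 2) ^ (m + 1)) := by
  have hne : ∀ k ∈ K, i ≠ k := fun k hk h => hi (h ▸ hk)
  have key := pexp_trace_gramSum_pow_le (n := Unit)
    (fun i => rowWeight_nonneg (h0 i) (h1 i)) (fun i => sum_rowWeight (ρ i)) K
    (fun a k (_ : Unit) => (ctrMat ρ a * (ctrMat ρ a)ᵀ) i k) (fun _ => 1)
    (fun a => t * (ctrMat ρ a * (ctrMat ρ a)ᵀ) i i) (fun _ => zero_le_one)
    (fun a => mul_nonneg ht0 (mul_transpose_diag_nonneg _ i)) (fun _ _ _ _ => rfl)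
    (by
      intro k hk l _ hlk a x
      funext _
      simp only [mul_transpose_apply', ctrMat_update_of_ne ρ a hlk,
        ctrMat_update_of_ne ρ a (hne k hk)])
    -- With row i of W fixed, the entry (i, k) is linear in row k, with variance at most t times the
    -- squared norm of row i, which is the diagonal entry (i, i).
    (by
      intro k hk a u
      simp only [mul_transpose_apply', ctrMat_update_self, ctrMat_update_of_ne ρ a (hne k hk),
        dotProduct_unit]
      have h := sum_rowWeight_sq_le (h0 k) (ht k) (fun j => ctrMat ρ a i j)
      calc _ = u () ^ 2 * ∑ x, rowWeight (ρ k) x *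
            (∑ j, ctr (ρ k j) (x j) * ctrMat ρ a i j) ^ 2 := by
            rw [Finset.mul_sum]
            refine Finset.sum_congr rfl fun x _ => ?_
            rw [show ∑ j, ctrMat ρ a i j * ctr (ρ k j) (x j)
              = ∑ j, ctr (ρ k j) (x j) * ctrMat ρ a i j from
              Finset.sum_congr rfl fun j _ => mul_comm _ _]
            ring
        _ ≤ u () ^ 2 * (t * ∑ j, ctrMat ρ a i j ^ 2) := by gcongr
        _ = _ := by
            simp only [sq]
            ring) m
  simp only [trace_gramSum_unit_pow, one_mul, dotProduct_unit] at key
  refine key.trans (le_of_eq ?_)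
  rw [pexp_add, pexp_const_mul, pexp_sum, bexp, ← pexp_const_mul]
  congr 1
  · congr 1
    funext a
    simp only [Fintype.card_unit, Nat.cast_one, mul_one]
    rw [← mul_pow]
    congr 1
    ring
  · simp only [bexp, sq]

end Model

end BSBM

namespace BSBM

/-! ### Spectral norms of diagonal parts and of off-diagonal blocks. -/

section SpectralNorm

open Matrix

variable {n : ℕ}

lemma specNorm_nonneg (M : Matrix (Fin n) (Fin n) ℝ) : 0 ≤ specNorm M := norm_nonneg _

lemma specNorm_add_le (M M' : Matrix (Fin n) (Fin n) ℝ) :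
    specNorm (M + M') ≤ specNorm M + specNorm M' := by
  unfold specNorm
  rw [map_add]
  exact norm_add_le _ _

lemma specNorm_smul (c : ℝ) (M : Matrix (Fin n) (Fin n) ℝ) :
    specNorm (c • M) = |c| * specNorm M := by
  unfold specNorm
  rw [map_smul, norm_smul, Real.norm_eq_abs]

lemma specNorm_sum_le {α : Type*} (s : Finset α) (f : α → Matrix (Fin n) (Fin n) ℝ) :
    specNorm (∑ k ∈ s, f k) ≤ ∑ k ∈ s, specNorm (f k) := by
  unfold specNorm
  rw [map_sum]
  exact norm_sum_le _ _

lemma specNorm_mul_le (M M' : Matrix (Fin n) (Fin n) ℝ) :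
    specNorm (M * M') ≤ specNorm M * specNorm M' := by
  unfold specNorm
  rw [map_mul]
  exact norm_mul_le _ _

open scoped Matrix.Norms.L2Operator in
lemma specNorm_diagonal (d : Fin n → ℝ) : specNorm (diagonal d) = ‖d‖ := by
  unfold specNorm
  rw [Matrix.l2_opNorm_toEuclideanCLM, Matrix.l2_opNorm_diagonal]

lemma norm_sq_eq_dotProduct (x : EuclideanSpace ℝ (Fin n)) : ‖x‖ ^ 2 = x.ofLp ⬝ᵥ x.ofLp := by
  rw [EuclideanSpace.norm_sq_eq]
  simp [dotProduct, sq]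

lemma dotProduct_mulVec_le_specNorm (M : Matrix (Fin n) (Fin n) ℝ) (u : Fin n → ℝ) :
    u ⬝ᵥ (M *ᵥ u) ≤ specNorm M * (u ⬝ᵥ u) := by
  have h := real_inner_le_norm (WithLp.toLp 2 u) (Matrix.toEuclideanCLM (n := Fin n) (𝕜 := ℝ) M
    (WithLp.toLp 2 u))
  rw [Matrix.inner_toEuclideanCLM] at h
  have h2 := (Matrix.toEuclideanCLM (n := Fin n) (𝕜 := ℝ) M).le_opNorm (WithLp.toLp 2 u)
  have h3 := norm_sq_eq_dotProduct (WithLp.toLp 2 u)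
  simp only at h h3
  rw [← h3]
  unfold specNorm
  calc _ ≤ _ := h
    _ ≤ ‖WithLp.toLp 2 u‖ * (‖Matrix.toEuclideanCLM (n := Fin n) (𝕜 := ℝ) M‖ *
        ‖WithLp.toLp 2 u‖) := by gcongr
    _ = _ := by ring

lemma specNorm_sq_le {M : Matrix (Fin n) (Fin n) ℝ} {c : ℝ} (hc : 0 ≤ c)
    (h : ∀ x : Fin n → ℝ, (M *ᵥ x) ⬝ᵥ (M *ᵥ x) ≤ c * (x ⬝ᵥ x)) : specNorm M ^ 2 ≤ c := by
  have h1 : specNorm M ≤ Real.sqrt c := by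
    refine ContinuousLinearMap.opNorm_le_bound _ (Real.sqrt_nonneg c) fun x => ?_
    refine abs_le_of_sq_le_sq' ?_ (by positivity) |>.2
    rw [mul_pow, Real.sq_sqrt hc, norm_sq_eq_dotProduct, norm_sq_eq_dotProduct,
      Matrix.ofLp_toEuclideanCLM]
    exact h _
  calc specNorm M ^ 2 ≤ Real.sqrt c ^ 2 := by
        gcongr
        exact specNorm_nonneg M
    _ = c := Real.sq_sqrt hc

/-- A soft maximum: the sum of exponentials dominates the excess of the largest entry over τ, so
only first exponential moments of single entries are needed. -/
lemma specNorm_diag_le (M : Matrix (Fin n) (Fin n) ℝ) (hM : ∀ i, 0 ≤ M i i) {τ : ℝ}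
    (hτ : 0 ≤ τ) : specNorm (diagonal M.diag) ≤ τ + ∑ i, Real.exp (M i i - τ) := by
  have hs : 0 ≤ ∑ i, Real.exp (M i i - τ) := Finset.sum_nonneg fun i _ => (Real.exp_pos _).le
  rw [specNorm_diagonal, pi_norm_le_iff_of_nonneg (by positivity)]
  intro i
  rw [Matrix.diag_apply, Real.norm_eq_abs, abs_of_nonneg (hM i)]
  have h1 := Real.add_one_le_exp (M i i - τ)
  have h2 := Finset.single_le_sum (f := fun i => Real.exp (M i i - τ))
    (fun i _ => (Real.exp_pos _).le) (Finset.mem_univ i)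
  linarith

/-- The part of a matrix with rows in `I` and columns outside `I`. -/
def crossPart (I : Finset (Fin n)) (M : Matrix (Fin n) (Fin n) ℝ) :
    Matrix (Fin n) (Fin n) ℝ :=
  Matrix.of fun i k => if i ∈ I ∧ k ∉ I then M i k else 0

/-- The diagonal projection onto the complement of `I`. -/
def complProj (I : Finset (Fin n)) : Matrix (Fin n) (Fin n) ℝ :=
  diagonal fun k => if k ∉ I then 1 else 0

/-- Row `i` of `M` restricted to the columns outside `I`. -/
def complRow (I : Finset (Fin n)) (M : Matrix (Fin n) (Fin n) ℝ) (i : Fin n) : Fin n → ℝ :=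
  fun k => if k ∉ I then M i k else 0

lemma specNorm_complProj_le (I : Finset (Fin n)) : specNorm (complProj I) ≤ 1 := by
  rw [complProj, specNorm_diagonal, pi_norm_le_iff_of_nonneg zero_le_one]
  intro k
  split_ifs <;> simp

lemma specNorm_compress_le (I : Finset (Fin n)) (M : Matrix (Fin n) (Fin n) ℝ) :
    specNorm (complProj I * M * complProj I) ≤ specNorm M := by
  have hP := specNorm_complProj_le I
  have h0 := specNorm_nonneg (complProj I)
  have hM := specNorm_nonneg M
  calc _ ≤ specNorm (complProj I) * specNorm M * specNorm (complProj I) :=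
        (specNorm_mul_le _ _).trans (mul_le_mul_of_nonneg_right (specNorm_mul_le _ _) h0)
    _ ≤ 1 * specNorm M * 1 := by gcongr
    _ = _ := by ring

lemma specNorm_le_hollow_add (M : Matrix (Fin n) (Fin n) ℝ) :
    specNorm M ≤ specNorm (hollow M) + specNorm (diagonal M.diag) := by
  have h := specNorm_add_le (hollow M) (diagonal M.diag)
  rwa [hollow, sub_add_cancel] at h

lemma dotProduct_gramSum_mulVec {ι m : Type*} [Fintype m] (I : Finset ι) (v : ι → m → ℝ)
    (x : m → ℝ) : x ⬝ᵥ (gramSum I v *ᵥ x) = ∑ i ∈ I, (v i ⬝ᵥ x) ^ 2 := by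
  rw [gramSum, Matrix.sum_mulVec, dotProduct_sum]
  refine Finset.sum_congr rfl fun i _ => ?_
  rw [Matrix.vecMulVec_mulVec, dotProduct_smul, dotProduct_comm x]
  simp [sq]

lemma crossPart_mulVec_dotProduct (I : Finset (Fin n)) (M : Matrix (Fin n) (Fin n) ℝ)
    (x : Fin n → ℝ) : (crossPart I M *ᵥ x) ⬝ᵥ (crossPart I M *ᵥ x)
      = x ⬝ᵥ (gramSum I (complRow I M) *ᵥ x) := by
  rw [dotProduct_gramSum_mulVec]
  change ∑ i, (crossPart I M *ᵥ x) i * (crossPart I M *ᵥ x) i = _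
  rw [← Finset.sum_subset (Finset.subset_univ I)]
  · refine Finset.sum_congr rfl fun i hi => ?_
    simp [Matrix.mulVec, crossPart, complRow, dotProduct, hi, sq]
  · intro i _ hi
    simp [Matrix.mulVec, crossPart, dotProduct, hi]

/-- Each eigenvalue satisfies l ≤ τ + τ⁻ᵐ l^(m+1). This form avoids roots of traces and is
pointwise, so τ may itself be random. -/
lemma specNorm_crossPart_sq_le (I : Finset (Fin n)) (M : Matrix (Fin n) (Fin n) ℝ) {τ : ℝ}
    (hτ : 0 < τ) (m : ℕ) : specNorm (crossPart I M) ^ 2 ≤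
      τ + τ⁻¹ ^ m * (gramSum I (complRow I M) ^ (m + 1)).trace := by
  obtain ⟨l, u, hl, -, hq, ht⟩ := exists_spectral (gramSum_posSemidef I (complRow I M))
  have hle : ∀ i, l i ≤ τ + τ⁻¹ ^ m * (gramSum I (complRow I M) ^ (m + 1)).trace := by
    intro i
    have h1 : l i ^ (m + 1) ≤ (gramSum I (complRow I M) ^ (m + 1)).trace := by
      rw [ht]
      exact Finset.single_le_sum (f := fun i => l i ^ (m + 1))
        (fun i _ => pow_nonneg (hl i) _) (Finset.mem_univ i)
    have h2 : l i ≤ τ + τ⁻¹ ^ m * l i ^ (m + 1) := by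
      rcases le_total (l i) τ with h | h
      · have : 0 ≤ τ⁻¹ ^ m * l i ^ (m + 1) := by have := hl i; positivity
        linarith
      · have h3 : 1 ≤ (τ⁻¹ * l i) ^ m := by
          apply one_le_pow₀
          rw [inv_mul_eq_div, one_le_div hτ]
          exact h
        have h4 : τ⁻¹ ^ m * l i ^ (m + 1) = (τ⁻¹ * l i) ^ m * l i := by ring
        rw [h4]
        nlinarith [hl i]
    have h5 : τ⁻¹ ^ m * l i ^ (m + 1) ≤
        τ⁻¹ ^ m * (gramSum I (complRow I M) ^ (m + 1)).trace := by gcongr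
    linarith
  have htr : 0 ≤ (gramSum I (complRow I M) ^ (m + 1)).trace := by
    rw [ht]; exact Finset.sum_nonneg fun i _ => pow_nonneg (hl i) _
  refine specNorm_sq_le (by positivity) fun x => ?_
  rw [crossPart_mulVec_dotProduct]
  have e1 := hq 1 x
  have e0 := hq 0 x
  simp only [pow_one, pow_zero, Matrix.one_mulVec, one_mul] at e0 e1
  rw [e1, e0, Finset.mul_sum]
  exact Finset.sum_le_sum fun i _ => mul_le_mul_of_nonneg_right (hle i) (sq_nonneg _)

end SpectralNorm

/-! ### Decoupling the hollowed matrix by random index sets. -/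

section Decoupling

variable {n : ℕ}

lemma pexp_sq_le {ι R : Type*} [Fintype ι] [Fintype R] [DecidableEq ι] {π : ι → R → ℝ}
    (h0 : ∀ i b, 0 ≤ π i b) (h1 : ∀ i, ∑ b, π i b = 1) (f : (ι → R) → ℝ) :
    pexp π f ^ 2 ≤ pexp π (fun a => f a ^ 2) := by
  set c := pexp π f with hc
  have h : 0 ≤ pexp π (fun a => f a ^ 2 + ((-2 * c) * f a + c ^ 2)) :=
    pexp_nonneg h0 fun a => by nlinarith [sq_nonneg (f a - c)]
  rw [pexp_add, pexp_add, pexp_const_mul, pexp_const h1, ← hc] at h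
  nlinarith

/-- The uniform weights on signs. -/
noncomputable def coin (_ : Fin n) (_ : Bool) : ℝ := 1 / 2

/-- The set selected by a choice of bits. -/
def selected (s : Fin n → Bool) : Finset (Fin n) := Finset.univ.filter fun i => s i = true

lemma sum_coin (i : Fin n) : ∑ b, coin i b = 1 := by simp [coin]

lemma coin_nonneg (i : Fin n) (b : Bool) : 0 ≤ coin i b := by simp [coin]

lemma pexp_coin_cross {i k : Fin n} (hik : i ≠ k) :
    pexp coin (fun s => if i ∈ selected s ∧ k ∉ selected s then (1 : ℝ) else 0) = 1 / 4 := by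
  rw [pexp_resample sum_coin k]
  have h : ∀ s : Fin n → Bool, ∑ b, coin k b * (if i ∈ selected (Function.update s k b) ∧
      k ∉ selected (Function.update s k b) then (1 : ℝ) else 0)
      = (fun c : Bool => if c then (1 / 2 : ℝ) else 0) (s i) := by
    intro s
    simp [coin, selected, hik]
  simp only [h]
  rw [pexp_marginal sum_coin i fun c : Bool => if c then (1 / 2 : ℝ) else 0]
  norm_num [coin]

/-- Each off-diagonal position falls in I × Iᶜ with probability 1/4, and a diagonal position never
does. -/
lemma hollow_eq_sum_crossPart (M : Matrix (Fin n) (Fin n) ℝ) :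
    hollow M = ∑ s : Fin n → Bool,
      ((4 : ℝ) * ∏ i, coin i (s i)) • crossPart (selected s) M := by
  ext i k
  rw [Matrix.sum_apply]
  simp only [Matrix.smul_apply, crossPart, Matrix.of_apply, smul_eq_mul]
  by_cases hik : i = k
  · subst hik
    simp [hollow]
  · have h := pexp_coin_cross hik
    have h2 : ∑ s : Fin n → Bool, (4 * ∏ i, coin i (s i)) *
        (if i ∈ selected s ∧ k ∉ selected s then M i k else 0)
        = 4 * M i k * pexp coin (fun s => if i ∈ selected s ∧ k ∉ selected s then (1 : ℝ) else 0) := by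
      rw [pexp, Finset.mul_sum]
      refine Finset.sum_congr rfl fun s _ => ?_
      split_ifs <;> ring
    rw [h2, h]
    simp [hollow, Matrix.diagonal_apply_ne _ hik]
    ring

lemma specNorm_hollow_sq_le (M : Matrix (Fin n) (Fin n) ℝ) :
    specNorm (hollow M) ^ 2 ≤
      16 * pexp coin (fun s => specNorm (crossPart (selected s) M) ^ 2) := by
  have h1 : specNorm (hollow M) ≤ 4 * pexp coin (fun s => specNorm (crossPart (selected s) M)) := by
    rw [hollow_eq_sum_crossPart]
    refine (specNorm_sum_le _ _).trans (le_of_eq ?_)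
    rw [pexp, Finset.mul_sum]
    refine Finset.sum_congr rfl fun s _ => ?_
    rw [specNorm_smul, abs_of_nonneg, mul_assoc]
    exact mul_nonneg (by norm_num) (Finset.prod_nonneg fun i _ => coin_nonneg _ _)
  have h2 := pexp_sq_le coin_nonneg sum_coin
    (fun s : Fin n → Bool => specNorm (crossPart (selected s) M))
  have h3 := specNorm_nonneg (hollow M)
  calc _ ≤ (4 * pexp coin (fun s => specNorm (crossPart (selected s) M))) ^ 2 := by gcongr
    _ ≤ _ := by rw [mul_pow]; linarith

end Decoupling

end BSBM

namespace BSBM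

/-! ### The self-bounding second-moment estimate. -/

section CrossMoment

open Matrix

variable {n : ℕ} {κ : Type*} [Fintype κ] [DecidableEq κ] {ρ : Fin n → κ → ℝ} {t : ℝ}

lemma bexp_const_mul (c : ℝ) (f : (Fin n → κ → Bool) → ℝ) :
    bexp ρ (fun a => c * f a) = c * bexp ρ f := pexp_const_mul _ c f

lemma bexp_add (f g : (Fin n → κ → Bool) → ℝ) :
    bexp ρ (fun a => f a + g a) = bexp ρ f + bexp ρ g := pexp_add _ f g

lemma bexp_sum {α : Type*} (s : Finset α) (f : α → (Fin n → κ → Bool) → ℝ) :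
    bexp ρ (fun a => ∑ k ∈ s, f k a) = ∑ k ∈ s, bexp ρ (f k) := pexp_sum _ s f

lemma compress_apply (I : Finset (Fin n)) (M : Matrix (Fin n) (Fin n) ℝ) (k l : Fin n) :
    (complProj I * M * complProj I) k l = if k ∉ I ∧ l ∉ I then M k l else 0 := by
  rw [complProj, Matrix.mul_diagonal, Matrix.diagonal_mul]
  by_cases hk : k ∈ I <;> by_cases hl : l ∈ I <;> simp [hk, hl]

lemma complRow_dotProduct_self (I : Finset (Fin n)) (M : Matrix (Fin n) (Fin n) ℝ) (i : Fin n) :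
    complRow I M i ⬝ᵥ complRow I M i = ∑ k ∈ Iᶜ, M i k ^ 2 := by
  rw [dotProduct, ← Finset.sum_subset (Finset.subset_univ Iᶜ)]
  · refine Finset.sum_congr rfl fun k hk => ?_
    simp [complRow, Finset.mem_compl.1 hk, sq]
  · intro k _ hk
    have : k ∈ I := by simpa using hk
    simp [complRow, this]

lemma gram_update_of_ne (a : Fin n → κ → Bool) {i k l : Fin n} (hk : k ≠ i) (hl : l ≠ i)
    (x : κ → Bool) :
    (ctrMat ρ (Function.update a i x) * (ctrMat ρ (Function.update a i x))ᵀ) k l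
      = (ctrMat ρ a * (ctrMat ρ a)ᵀ) k l := by
  simp only [mul_transpose_apply', ctrMat_update_of_ne ρ a hk, ctrMat_update_of_ne ρ a hl]

/-- For i in I the row of the block is P W wᵢ, where wᵢ is row i of W and P W involves only other
rows. Its covariance is thus at most t P W Wᵀ P. -/
lemma sum_rowWeight_complRow_sq_le (h0 : ∀ i j, 0 ≤ ρ i j) (ht0 : 0 ≤ t)
    (ht : ∀ i j, ρ i j ≤ t) {I : Finset (Fin n)} {i : Fin n} (hi : i ∈ I)
    (a : Fin n → κ → Bool) (u : Fin n → ℝ) :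
    ∑ x, rowWeight (ρ i) x * (u ⬝ᵥ complRow I (ctrMat ρ (Function.update a i x) *
        (ctrMat ρ (Function.update a i x))ᵀ) i) ^ 2 ≤
      t * specNorm (complProj I * (ctrMat ρ a * (ctrMat ρ a)ᵀ) * complProj I) * (u ⬝ᵥ u) := by
  set y : κ → ℝ := (ctrMat ρ a)ᵀ *ᵥ (complProj I *ᵥ u) with hy
  have e1 : ∀ x, u ⬝ᵥ complRow I (ctrMat ρ (Function.update a i x) *
      (ctrMat ρ (Function.update a i x))ᵀ) i = ∑ j, ctr (ρ i j) (x j) * y j := by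
    intro x
    simp only [hy, dotProduct, complRow, Matrix.mulVec, Finset.mul_sum, complProj]
    rw [Finset.sum_comm]
    refine Finset.sum_congr rfl fun k _ => ?_
    by_cases hk : k ∈ I
    · simp [Matrix.diagonal_apply, hk]
    · have hki : k ≠ i := fun h => hk (h ▸ hi)
      rw [if_pos hk, mul_transpose_apply', Finset.mul_sum]
      refine Finset.sum_congr rfl fun j _ => ?_
      simp only [ctrMat_update_self, ctrMat_update_of_ne ρ a hki]
      simp [Matrix.diagonal_apply, hk]
      ring
  have e2 : ∑ j, y j ^ 2 =
      u ⬝ᵥ ((complProj I * (ctrMat ρ a * (ctrMat ρ a)ᵀ) * complProj I) *ᵥ u) := by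
    have hP : (complProj I)ᵀ = complProj I := Matrix.diagonal_transpose _
    have : ∑ j, y j ^ 2 = y ⬝ᵥ y := by simp [dotProduct, sq]
    rw [this, ← Matrix.mulVec_mulVec, ← Matrix.mulVec_mulVec, ← Matrix.mulVec_mulVec, ← hy,
      Matrix.dotProduct_mulVec, Matrix.dotProduct_mulVec, ← Matrix.mulVec_transpose,
      ← Matrix.mulVec_transpose, hP, Matrix.transpose_transpose, dotProduct_comm]
  simp only [e1]
  refine (sum_rowWeight_sq_le (h0 i) (ht i) y).trans ?_
  rw [e2, mul_assoc t]
  exact mul_le_mul_of_nonneg_left (dotProduct_mulVec_le_specNorm _ _) ht0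

lemma bexp_crossPart_sq_le (h0 : ∀ i j, 0 ≤ ρ i j) (h1 : ∀ i j, ρ i j ≤ 1) (ht0 : 0 ≤ t)
    (ht : ∀ i j, ρ i j ≤ t) (I : Finset (Fin n)) (m : ℕ) {B : ℝ} (hB : 0 < B)
    (hn : (n : ℝ) ≤ Real.exp 1 ^ (m + 1))
    (hrow : ∑ i ∈ I, bexp ρ (fun a => (∑ k ∈ Iᶜ, ((ctrMat ρ a * (ctrMat ρ a)ᵀ) i k) ^ 2) ^ (m + 1))
      ≤ B ^ (m + 1)) :
    bexp ρ (fun a => specNorm (crossPart I (ctrMat ρ a * (ctrMat ρ a)ᵀ)) ^ 2) ≤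
      4 * Real.exp 1 ^ 2 * n * t * bexp ρ (fun a =>
        specNorm (complProj I * (ctrMat ρ a * (ctrMat ρ a)ᵀ) * complProj I))
      + 4 * (m + 1) * B := by
  set G : (Fin n → κ → Bool) → Matrix (Fin n) (Fin n) ℝ :=
    fun a => ctrMat ρ a * (ctrMat ρ a)ᵀ with hG
  set F : (Fin n → κ → Bool) → ℝ := fun a => specNorm (complProj I * G a * complProj I) with hF
  have hF0 : ∀ a, 0 ≤ F a := fun a => specNorm_nonneg _
  -- The first summand matches the variance term of the Rosenthal bound: one factor e comes from
  -- that bound, the other from n ≤ e^(m+1). The second keeps τ⁻ᵐ(m+1)ᵐ below B⁻ᵐ.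
  set τ : (Fin n → κ → Bool) → ℝ :=
    fun a => 2 * Real.exp 1 ^ 2 * n * (t * F a) + (m + 1) * B with hτ
  have hmB : 0 < (m + 1) * B := by positivity
  have hτ0 : ∀ a, (m + 1) * B ≤ τ a := fun a => by
    have := hF0 a
    have : 0 ≤ 2 * Real.exp 1 ^ 2 * n * (t * F a) := by positivity
    simp only [hτ]; linarith
  have hτp : ∀ a, 0 < τ a := fun a => hmB.trans_le (hτ0 a)
  -- The compression involves only rows outside I, so τ is frozen when a row in I is resampled and
  -- τ⁻ᵐ is an admissible weight g.
  have hFI : ∀ i ∈ I, ∀ a x, F (Function.update a i x) = F a := by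
    intro i hi a x
    simp only [hF]
    congr 1
    ext k l
    rw [compress_apply, compress_apply]
    by_cases hkl : k ∉ I ∧ l ∉ I
    · rw [if_pos hkl, if_pos hkl]
      exact gram_update_of_ne a (fun h => hkl.1 (by rwa [h])) (fun h => hkl.2 (by rwa [h])) x
    · rw [if_neg hkl, if_neg hkl]
  have key := pexp_trace_gramSum_pow_le
    (fun i => rowWeight_nonneg (h0 i) (h1 i)) (fun i => sum_rowWeight (ρ i)) I
    (fun a => complRow I (G a)) (fun a => (τ a)⁻¹ ^ m) (fun a => t * F a)
    (fun a => pow_nonneg (inv_nonneg.2 (hτp a).le) m) (fun a => mul_nonneg ht0 (hF0 a))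
    (fun i hi a x => by simp only [hτ, hFI i hi])
    (by
      intro i hi k _ hki a x
      funext l
      simp only [complRow]
      by_cases hl : l ∈ I
      · simp [hl]
      · rw [if_pos hl, if_pos hl]
        exact gram_update_of_ne a hki (fun h => hl (by rwa [h])) x)
    (fun i hi a u => sum_rowWeight_complRow_sq_le h0 ht0 ht hi a u) m
  have hpt : ∀ a, (τ a)⁻¹ ^ m * ((2 * (Real.exp 1 * I.card * (t * F a))) ^ (m + 1) *
      Fintype.card (Fin n) + 2 * (m + 1 : ℝ) ^ m *
        ∑ i ∈ I, (complRow I (G a) i ⬝ᵥ complRow I (G a) i) ^ (m + 1))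
      ≤ τ a + 2 * B⁻¹ ^ m * ∑ i ∈ I, (∑ k ∈ Iᶜ, (G a i k) ^ 2) ^ (m + 1) := by
    intro a
    simp only [complRow_dotProduct_self]
    have hFa := hF0 a
    have hS : 0 ≤ ∑ i ∈ I, (∑ k ∈ Iᶜ, (G a i k) ^ 2) ^ (m + 1) :=
      Finset.sum_nonneg fun i _ => pow_nonneg (Finset.sum_nonneg fun k _ => sq_nonneg _) _
    have hinv : 0 ≤ (τ a)⁻¹ ^ m := pow_nonneg (inv_nonneg.2 (hτp a).le) m
    rw [mul_add]
    refine add_le_add ?_ ?_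
    · have hI : (I.card : ℝ) ≤ n := by
        have := Finset.card_le_univ I
        rw [Fintype.card_fin] at this
        exact_mod_cast this
      have hle : (2 * (Real.exp 1 * I.card * (t * F a))) ^ (m + 1) * Fintype.card (Fin n)
          ≤ τ a ^ (m + 1) := by
        rw [Fintype.card_fin]
        calc _ ≤ (2 * (Real.exp 1 * n * (t * F a))) ^ (m + 1) * Real.exp 1 ^ (m + 1) := by
              gcongr
          _ = (2 * Real.exp 1 ^ 2 * n * (t * F a)) ^ (m + 1) := by
              rw [← mul_pow]; congr 1; ring
          _ ≤ _ := by
              gcongr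
              simp only [hτ]; linarith
      calc _ ≤ (τ a)⁻¹ ^ m * τ a ^ (m + 1) := by gcongr
        _ = τ a := by
            rw [pow_succ, ← mul_assoc, ← mul_pow, inv_mul_cancel₀ (hτp a).ne', one_pow, one_mul]
    · have hle : (τ a)⁻¹ ^ m ≤ ((m + 1) * B)⁻¹ ^ m := by
        have := hτ0 a
        gcongr
      have hcancel : ((m + 1) * B)⁻¹ ^ m * (m + 1 : ℝ) ^ m = B⁻¹ ^ m := by
        rw [← mul_pow]; congr 1; field_simp
      calc _ ≤ ((m + 1) * B)⁻¹ ^ m * (2 * (m + 1 : ℝ) ^ m *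
            ∑ i ∈ I, (∑ k ∈ Iᶜ, (G a i k) ^ 2) ^ (m + 1)) := by gcongr
        _ = 2 * (((m + 1) * B)⁻¹ ^ m * (m + 1 : ℝ) ^ m) *
            ∑ i ∈ I, (∑ k ∈ Iᶜ, (G a i k) ^ 2) ^ (m + 1) := by ring
        _ = _ := by rw [hcancel]
  have hτE : bexp ρ τ = 2 * Real.exp 1 ^ 2 * n * t * bexp ρ F + (m + 1) * B := by
    rw [← bexp_const_mul]
    conv_rhs => rw [← bexp_const (ρ := ρ) ((m + 1) * B)]
    rw [← bexp_add]
    congr 1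
    funext a
    simp only [hτ]
    ring
  have hrest : bexp ρ (fun a => 2 * B⁻¹ ^ m * ∑ i ∈ I, (∑ k ∈ Iᶜ, (G a i k) ^ 2) ^ (m + 1))
      ≤ 2 * B := by
    rw [bexp_const_mul, bexp_sum]
    calc _ ≤ 2 * B⁻¹ ^ m * B ^ (m + 1) := by gcongr
      _ = 2 * B := by
        rw [pow_succ, mul_assoc, ← mul_assoc (B⁻¹ ^ m), ← mul_pow, inv_mul_cancel₀ hB.ne',
          one_pow, one_mul]
  have hstep : bexp ρ (fun a => specNorm (crossPart I (G a)) ^ 2) ≤ bexp ρ τ +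
      (bexp ρ τ + 2 * B) := by
    calc _ ≤ bexp ρ (fun a => τ a + (τ a)⁻¹ ^ m *
          (gramSum I (complRow I (G a)) ^ (m + 1)).trace) :=
          bexp_mono h0 h1 fun a => specNorm_crossPart_sq_le I (G a) (hτp a) m
      _ ≤ bexp ρ τ + bexp ρ (fun a => τ a +
            2 * B⁻¹ ^ m * ∑ i ∈ I, (∑ k ∈ Iᶜ, (G a i k) ^ 2) ^ (m + 1)) := by
          rw [bexp_add τ]
          exact add_le_add le_rfl (key.trans (bexp_mono h0 h1 hpt))
      _ ≤ _ := by
          rw [bexp_add τ]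
          linarith
  rw [hτE] at hstep
  have hmB' : 0 ≤ m * B := by positivity
  linarith

/-- Self-bounding estimate for the second moment of the hollowed Gram matrix. -/
lemma bexp_hollow_sq_le (h0 : ∀ i j, 0 ≤ ρ i j) (h1 : ∀ i j, ρ i j ≤ 1) (ht0 : 0 ≤ t)
    (ht : ∀ i j, ρ i j ≤ t) (m : ℕ) {B τ : ℝ} (hB : 0 < B) (hτ : 0 ≤ τ)
    (hn : (n : ℝ) ≤ Real.exp 1 ^ (m + 1))
    (hrow : ∀ i, ∀ K : Finset (Fin n), i ∉ K → n * bexp ρ (fun a =>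
      (∑ k ∈ K, ((ctrMat ρ a * (ctrMat ρ a)ᵀ) i k) ^ 2) ^ (m + 1)) ≤ B ^ (m + 1)) :
    bexp ρ (fun a => specNorm (hollow (ctrMat ρ a * (ctrMat ρ a)ᵀ)) ^ 2) ≤
      (64 * Real.exp 1 ^ 2 * n * t) ^ 2 + 128 * Real.exp 1 ^ 2 * n * t *
        (τ + n * (Real.exp (-τ) * Real.exp (Fintype.card κ * (t * (Real.exp 1 - 1)))))
      + 128 * (m + 1) * B := by
  set G : (Fin n → κ → Bool) → Matrix (Fin n) (Fin n) ℝ :=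
    fun a => ctrMat ρ a * (ctrMat ρ a)ᵀ with hG
  set D := τ + n * (Real.exp (-τ) * Real.exp (Fintype.card κ * (t * (Real.exp 1 - 1)))) with hD
  set Y := bexp ρ (fun a => specNorm (hollow (G a))) with hY
  set X := bexp ρ (fun a => specNorm (hollow (G a)) ^ 2) with hX
  have hF : ∀ I : Finset (Fin n), bexp ρ (fun a => specNorm (complProj I * G a * complProj I))
      ≤ Y + D := by
    intro I
    calc _ ≤ bexp ρ (fun a => specNorm (hollow (G a)) +
          (τ + ∑ i, Real.exp (-τ) * Real.exp (1 * G a i i))) := by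
          refine bexp_mono h0 h1 fun a => (specNorm_compress_le I _).trans
            ((specNorm_le_hollow_add _).trans (add_le_add le_rfl
              ((specNorm_diag_le _ (mul_transpose_diag_nonneg _) hτ).trans (le_of_eq ?_))))
          congr 1
          refine Finset.sum_congr rfl fun i _ => ?_
          rw [← Real.exp_add]
          congr 1
          ring
      _ ≤ _ := by
          rw [bexp_add, bexp_add, bexp_const, bexp_sum, hD]
          gcongr
          calc _ ≤ ∑ _i : Fin n, Real.exp (-τ) *
                Real.exp (Fintype.card κ * (t * (Real.exp 1 - 1))) := by
                refine Finset.sum_le_sum fun i _ => ?_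
                rw [bexp_const_mul]
                gcongr
                exact bexp_exp_diag_le h0 h1 ht zero_le_one i
            _ = _ := by simp
  have hI : ∀ I : Finset (Fin n), bexp ρ (fun a => specNorm (crossPart I (G a)) ^ 2) ≤
      4 * Real.exp 1 ^ 2 * n * t * (Y + D) + 4 * (m + 1) * B := by
    intro I
    refine (bexp_crossPart_sq_le h0 h1 ht0 ht I m hB hn ?_).trans ?_
    · have hB' : 0 ≤ B ^ (m + 1) := by positivity
      rcases Nat.eq_zero_or_pos n with hn0 | hn0
      · subst hn0
        simpa [Finset.eq_empty_of_isEmpty I] using hB'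
      have hnR : (0 : ℝ) < n := by exact_mod_cast hn0
      calc _ ≤ ∑ _i ∈ I, B ^ (m + 1) / n := by
            refine Finset.sum_le_sum fun i hi => ?_
            rw [le_div_iff₀ hnR, mul_comm]
            exact hrow i Iᶜ (by simpa using hi)
        _ = I.card * (B ^ (m + 1) / n) := by simp
        _ ≤ n * (B ^ (m + 1) / n) := by
            gcongr
            simpa using Finset.card_le_univ I
        _ = _ := by field_simp
    · gcongr
      exact hF I
  have hdec : X ≤ 16 * (4 * Real.exp 1 ^ 2 * n * t * (Y + D) + 4 * (m + 1) * B) := by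
    calc X ≤ bexp ρ (fun a => 16 * pexp coin (fun s =>
          specNorm (crossPart (selected s) (G a)) ^ 2)) :=
          bexp_mono h0 h1 fun a => specNorm_hollow_sq_le _
      _ = 16 * pexp coin (fun s => bexp ρ (fun a =>
          specNorm (crossPart (selected s) (G a)) ^ 2)) := by
          rw [bexp_const_mul]
          congr 1
          simp only [pexp]
          rw [bexp_sum]
          exact Finset.sum_congr rfl fun s _ => bexp_const_mul _ _
      _ ≤ _ := by
          gcongr
          refine (pexp_mono coin_nonneg fun s => hI (selected s)).trans (le_of_eq ?_)
          exact pexp_const sum_coin _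
  have hYX : Y ^ 2 ≤ X :=
    pexp_sq_le (fun i => rowWeight_nonneg (h0 i) (h1 i)) (fun i => sum_rowWeight (ρ i)) _
  -- Young's inequality together with Y² ≤ X absorbs the linear term in Y into half of X.
  have hyoung : 64 * Real.exp 1 ^ 2 * n * t * Y ≤
      1 / 2 * (64 * Real.exp 1 ^ 2 * n * t) ^ 2 + 1 / 2 * Y ^ 2 := by
    nlinarith [sq_nonneg (64 * Real.exp 1 ^ 2 * n * t - Y)]
  linarith

end CrossMoment

end BSBM

namespace BSBM

/-! ### From the probability space to finite sums. -/

section Transfer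

lemma edgeProb_nonneg {δ p : ℝ} (hδ : δ ∈ Set.Ioo (0 : ℝ) 2) (hp : 0 ≤ p) (s t : ℤˣ) :
    0 ≤ edgeProb δ p s t := by
  unfold edgeProb
  split_ifs
  · exact mul_nonneg hδ.1.le hp
  · exact mul_nonneg (sub_nonneg.2 hδ.2.le) hp

lemma edgeProb_le {δ p : ℝ} (hδ : δ ∈ Set.Ioo (0 : ℝ) 2) (hp : 0 ≤ p) (s t : ℤˣ) :
    edgeProb δ p s t ≤ 2 * p := by
  unfold edgeProb
  split_ifs
  · exact mul_le_mul_of_nonneg_right hδ.2.le hp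
  · exact mul_le_mul_of_nonneg_right (by linarith [hδ.1]) hp

lemma bernoulliMeasure_eq_map (q : unitInterval) :
    bernoulliMeasure (1 : ℝ) 0 q
      = (bernoulliMeasure true false q).map (fun b : Bool => if b then (1 : ℝ) else 0) := by
  have hm : Measurable (fun b : Bool => if b then (1 : ℝ) else 0) := measurable_of_finite _
  rw [bernoulliMeasure_def, bernoulliMeasure_def, Measure.map_add _ _ hm]
  simp [Measure.map_smul, Measure.map_dirac' hm]

lemma bernoulliMeasure_bool_real_singleton (q : unitInterval) (b : Bool) :
    (bernoulliMeasure true false q).real {b} = bern q b := by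
  cases b <;> simp [bern]

variable {Ω : Type*} [MeasurableSpace Ω] {μ : Measure Ω} [IsProbabilityMeasure μ] {n₁ n₂ : ℕ}
  {δ p : ℝ} {η₁ : Fin n₁ → ℤˣ} {η₂ : Fin n₂ → ℤˣ} {A : Ω → Matrix (Fin n₁) (Fin n₂) ℝ}

lemma IsBSBM.integral_entry (h : IsBSBM μ δ p η₁ η₂ A) (i : Fin n₁) (j : Fin n₂) :
    ∫ ω, A ω i j ∂μ = edgeProb δ p (η₁ i) (η₂ j) := by
  obtain ⟨q, hq, hl⟩ := h.law i j
  rw [hl.integral_eq, integral_bernoulliMeasure]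
  simp [hq]

/-- Expectations of functions of the noise matrix are finite sums over Boolean matrices. -/
lemma IsBSBM.integral_noise (h : IsBSBM μ δ p η₁ η₂ A)
    {f : Matrix (Fin n₁) (Fin n₂) ℝ → ℝ} (hf : Continuous f) :
    Integrable (fun ω => f (noise μ A ω)) μ ∧ ∫ ω, f (noise μ A ω) ∂μ =
      bexp (fun i j => edgeProb δ p (η₁ i) (η₂ j))
        (fun a => f (ctrMat (fun i j => edgeProb δ p (η₁ i) (η₂ j)) a)) := by
  set ρ : Fin n₁ → Fin n₂ → ℝ := fun i j => edgeProb δ p (η₁ i) (η₂ j) with hρ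
  choose q hq hl using h.law
  set X : Ω → (Fin n₁ × Fin n₂ → ℝ) := fun ω ij => A ω ij.1 ij.2 with hX
  set F : (Fin n₁ × Fin n₂ → ℝ) → ℝ :=
    fun x => f (Matrix.of fun i j => x (i, j) - ρ i j) with hF
  set β : Bool → ℝ := fun b => if b then 1 else 0 with hβ
  set ν : Fin n₁ × Fin n₂ → Measure Bool := fun ij => bernoulliMeasure true false (q ij.1 ij.2)
    with hν
  have hXm : AEMeasurable X μ := aemeasurable_pi_lambda _ fun ij => (hl ij.1 ij.2).aemeasurable
  have hβm : Measurable (fun (a : Fin n₁ × Fin n₂ → Bool) ij => β (a ij)) :=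
    measurable_of_finite _
  -- By independence the joint law of the entries is a product of two-point laws, hence the image of
  -- a product measure on Boolean arrays.
  have hmap : μ.map X = (Measure.pi ν).map (fun a ij => β (a ij)) := by
    have h1 := (iIndepFun_iff_map_fun_eq_pi_map
      (fun ij : Fin n₁ × Fin n₂ => (hl ij.1 ij.2).aemeasurable)).1 h.indep
    rw [hX, h1, Measure.pi_map_pi (fun ij => (measurable_of_finite β).aemeasurable)]
    congr 1
    funext ij
    rw [(hl ij.1 ij.2).map_eq, bernoulliMeasure_eq_map]
  have hFc : Continuous F := by
    refine hf.comp ?_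
    refine continuous_matrix fun i j => ?_
    exact (continuous_apply (i, j)).sub continuous_const
  have hFm : AEStronglyMeasurable F (μ.map X) := hFc.aestronglyMeasurable
  have hFm' : AEStronglyMeasurable F ((Measure.pi ν).map (fun a ij => β (a ij))) :=
    hFc.aestronglyMeasurable
  have hfF : (fun ω => f (noise μ A ω)) = fun ω => F (X ω) := by
    funext ω
    simp only [hF, hX, noise]
    congr 1
    ext i j
    simp [h.integral_entry, hρ]
  have hfin : Integrable (fun a => F (fun ij => β (a ij))) (Measure.pi ν) := Integrable.of_finite
  have hint : Integrable F (μ.map X) := by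
    rw [hmap]
    exact (integrable_map_measure hFm' hβm.aemeasurable).2 hfin
  rw [hfF]
  refine ⟨(integrable_map_measure hFm hXm).1 hint, ?_⟩
  rw [← integral_map hXm hFm, hmap, integral_map hβm.aemeasurable hFm', integral_fintype hfin,
    bexp, pexp, ← Equiv.sum_comp (Equiv.curry (Fin n₁) (Fin n₂) Bool)]
  refine Finset.sum_congr rfl fun a _ => ?_
  rw [smul_eq_mul]
  congr 1
  rw [measureReal_def, Measure.pi_singleton, ENNReal.toReal_prod, Fintype.prod_prod_type]
  refine Finset.prod_congr rfl fun i _ => Finset.prod_congr rfl fun j _ => ?_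
  have := bernoulliMeasure_bool_real_singleton (q i j) (a (i, j))
  rw [measureReal_def, hq] at this
  exact this

lemma continuous_specNorm_hollow_sq :
    Continuous fun M : Matrix (Fin n₁) (Fin n₂) ℝ =>
      specNorm (hollow (M * M.transpose)) ^ 2 := by
  have h1 : Continuous fun M : Matrix (Fin n₁) (Fin n₁) ℝ => specNorm M := by
    unfold specNorm
    refine continuous_norm.comp ?_
    exact LinearMap.continuous_of_finiteDimensional
      (Matrix.toEuclideanCLM (n := Fin n₁) (𝕜 := ℝ)).toAlgEquiv.toLinearMap
  unfold hollow
  refine (h1.comp ?_).pow 2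
  fun_prop

end Transfer

/-! ### Choice of parameters and explicit constants. -/

section Constants

variable {n₁ n₂ : ℕ} {ρ : Fin n₁ → Fin n₂ → ℝ} {p C : ℝ}

lemma sq_mul_exp_le (q : ℝ) (hq : 0 ≤ q) :
    q ^ 2 * Real.exp (q / 8) ≤ 64 * Real.exp q := by
  have h1 : q ≤ 8 * Real.exp (q / 8) := by linarith [Real.add_one_le_exp (q / 8)]
  calc q ^ 2 * Real.exp (q / 8) ≤ (8 * Real.exp (q / 8)) ^ 2 * Real.exp (q / 8) := by gcongr
    _ = 64 * Real.exp (q / 8 + q / 8 + q / 8) := by rw [Real.exp_add, Real.exp_add]; ring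
    _ ≤ 64 * Real.exp q := by gcongr; linarith

lemma bexp_diag_pow_le_pow (h0 : ∀ i j, 0 ≤ ρ i j) (h1 : ∀ i j, ρ i j ≤ 1) (hp : 0 < p)
    (ht : ∀ i j, ρ i j ≤ 2 * p) (hC : 0 < C) (hn₂ : 0 < n₂) {q : ℕ} (hq : q ≠ 0)
    (hqp : C * q ≤ 3 * (n₂ * p)) (i : Fin n₁) :
    bexp ρ (fun a => ((ctrMat ρ a * (ctrMat ρ a).transpose) i i) ^ q) ≤
      (n₂ * p * Real.exp (2 * Real.exp (3 / C))) ^ q := by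
  have hqR : (0 : ℝ) < q := by exact_mod_cast Nat.pos_of_ne_zero hq
  have hnR : (0 : ℝ) < n₂ := by exact_mod_cast hn₂
  have hnp : 0 < n₂ * p := by positivity
  -- This choice makes the prefactor q/s equal to n₂p, while s ≤ 3/C keeps the exponential factor to
  -- a constant to the power q.
  set s : ℝ := q / (n₂ * p) with hs
  have hs0 : 0 < s := by positivity
  have hsC : s ≤ 3 / C := by
    rw [hs, div_le_div_iff₀ hnp hC]; linarith
  have hexp : Real.exp s - 1 ≤ s * Real.exp (3 / C) := by
    have h2 : Real.exp s - 1 ≤ s * Real.exp s := by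
      have h3 := Real.add_one_le_exp (-s)
      have h4 : Real.exp (-s) * Real.exp s = 1 := by rw [← Real.exp_add]; simp
      nlinarith [Real.exp_pos s]
    calc _ ≤ _ := h2
      _ ≤ _ := by gcongr
  refine (bexp_diag_pow_le h0 h1 ht hs0 i hq).trans ?_
  rw [mul_pow, ← Real.exp_nat_mul, Fintype.card_fin]
  have e1 : (q : ℝ) / s = n₂ * p := by rw [hs]; field_simp
  rw [e1]
  refine mul_le_mul_of_nonneg_left (Real.exp_le_exp.2 ?_) (by positivity)
  calc (n₂ : ℝ) * (2 * p * (Real.exp s - 1)) ≤ n₂ * (2 * p * (s * Real.exp (3 / C))) := by gcongr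
    _ = (s * (n₂ * p)) * (2 * Real.exp (3 / C)) := by ring
    _ = _ := by rw [hs, div_mul_cancel₀ _ hnp.ne']

lemma bexp_offDiag_pow_le_pow (h0 : ∀ i j, 0 ≤ ρ i j) (h1 : ∀ i j, ρ i j ≤ 1) (hp : 0 < p)
    (ht : ∀ i j, ρ i j ≤ 2 * p) (hC : 0 < C) (hn₁ : 0 < n₁) (hn₂ : 0 < n₂) {q : ℕ} (hq : q ≠ 0)
    {L : ℝ} (hL : 0 < L) (hLq : L ≤ q) (hqn : Real.exp q ≤ Real.exp 1 * n₁)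
    (hx : C ^ 2 ≤ n₁ * n₂ * p ^ 2 / L) {i k : Fin n₁} (hik : i ≠ k) :
    bexp ρ (fun a => (((ctrMat ρ a * (ctrMat ρ a).transpose) i k) ^ 2) ^ q) ≤
      2 * (256 / C ^ 2 * Real.exp (4 * Real.exp 1 * C ^ 2) * (n₁ * n₂ * p ^ 2 / L)) ^ q := by
  have hqR : (0 : ℝ) < q := by exact_mod_cast Nat.pos_of_ne_zero hq
  have hnR : (0 : ℝ) < n₂ := by exact_mod_cast hn₂
  have hnR₁ : (0 : ℝ) < n₁ := by exact_mod_cast hn₁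
  set x : ℝ := n₁ * n₂ * p ^ 2 / L with hxdef
  have hx0 : 0 < x := by positivity
  have hsx : 0 < Real.sqrt x := Real.sqrt_pos.2 hx0
  have hsx2 : Real.sqrt x ^ 2 = x := Real.sq_sqrt hx0.le
  have hCx : C ≤ Real.sqrt x := Real.le_sqrt_of_sq_le hx
  -- Taking s of order q/√x makes (2q/s)² a constant multiple of x. The factor C/8 and C ≤ √x give s
  -- ≤ q/8, so q² exp s stays within the budget exp q ≤ e n₁, which cancels the 1/n₁ coming from s².
  set s : ℝ := C / 8 * q / Real.sqrt x with hs
  have hs0 : 0 < s := by positivity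
  have hs8 : s ≤ q / 8 := by
    rw [hs, div_le_iff₀ hsx]
    nlinarith
  have e1 : (2 * q / s) ^ 2 = 256 / C ^ 2 * x := by
    rw [hs]
    field_simp
    rw [hsx2]
    ring
  have e2 : s ^ 2 = C ^ 2 * q ^ 2 / (64 * x) := by
    rw [hs, div_pow, hsx2]
    field_simp
    ring
  refine (bexp_offDiag_pow_le h0 h1 ht hs0 hik hq).trans ?_
  rw [e1, Fintype.card_fin]
  have hexp : (n₂ : ℝ) * ((2 * p) ^ 2 * (s ^ 2 * Real.exp s)) ≤
      q * (4 * Real.exp 1 * C ^ 2) := by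
    calc (n₂ : ℝ) * ((2 * p) ^ 2 * (s ^ 2 * Real.exp s))
        ≤ n₂ * ((2 * p) ^ 2 * (s ^ 2 * Real.exp (q / 8))) := by gcongr
      _ = C ^ 2 / 16 * L * (q ^ 2 * Real.exp (q / 8)) / n₁ := by
          rw [e2, hxdef]
          field_simp
          ring
      _ ≤ C ^ 2 / 16 * q * (64 * (Real.exp 1 * n₁)) / n₁ := by
          have h6 : (q : ℝ) ^ 2 * Real.exp (q / 8) ≤ 64 * (Real.exp 1 * n₁) :=
            (sq_mul_exp_le q hqR.le).trans (by gcongr)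
          exact div_le_div_of_nonneg_right
            (mul_le_mul (by gcongr) h6 (by positivity) (by positivity)) hnR₁.le
      _ = _ := by field_simp; ring
  calc (256 / C ^ 2 * x) ^ q * (2 * Real.exp (n₂ * ((2 * p) ^ 2 * (s ^ 2 * Real.exp s))))
      ≤ (256 / C ^ 2 * x) ^ q * (2 * Real.exp (q * (4 * Real.exp 1 * C ^ 2))) := by gcongr
    _ = _ := by
        rw [Real.exp_nat_mul, mul_right_comm (256 / C ^ 2), mul_pow _ (Real.exp _)]
        ring

/-- The constant in the bound on the row moments. -/
noncomputable def rowConst (C : ℝ) : ℝ :=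
  4 * Real.exp 1 ^ 2 * Real.exp (2 * Real.exp (3 / C)) +
    12 * Real.exp 1 ^ 2 * (256 / C ^ 2 * Real.exp (4 * Real.exp 1 * C ^ 2))

lemma rowConst_pos (hC : 0 < C) : 0 < rowConst C := by
  unfold rowConst; positivity

lemma bexp_row_pow_le_pow (h0 : ∀ i j, 0 ≤ ρ i j) (h1 : ∀ i j, ρ i j ≤ 1) (hp : 0 < p)
    (ht : ∀ i j, ρ i j ≤ 2 * p) (hC : 0 < C) (hn₁ : 0 < n₁) (hn₂ : 0 < n₂) (m : ℕ)
    {L : ℝ} (hL : 0 < L) (hLq : L ≤ m + 1) (hqL : (m + 1 : ℝ) ≤ 3 * L)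
    (hqn : Real.exp (m + 1) ≤ Real.exp 1 * n₁) (hn : (n₁ : ℝ) ≤ Real.exp 1 ^ (m + 1))
    (hx : C ^ 2 ≤ n₁ * n₂ * p ^ 2 / L) (hLp : C * L ≤ n₂ * p)
    (i : Fin n₁) (K : Finset (Fin n₁)) (hi : i ∉ K) :
    n₁ * bexp ρ (fun a =>
        (∑ k ∈ K, ((ctrMat ρ a * (ctrMat ρ a).transpose) i k) ^ 2) ^ (m + 1)) ≤
      (rowConst C * (n₁ * n₂ * p ^ 2)) ^ (m + 1) := by
  have hnR₁ : (0 : ℝ) < n₁ := by exact_mod_cast hn₁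
  have hnR : (0 : ℝ) < n₂ := by exact_mod_cast hn₂
  have hK : (K.card : ℝ) ≤ n₁ := by
    have := Finset.card_le_univ K
    rw [Fintype.card_fin] at this
    exact_mod_cast this
  set x : ℝ := n₁ * n₂ * p ^ 2 / L with hxdef
  have hx0 : 0 < x := by positivity
  set K1 := Real.exp (2 * Real.exp (3 / C)) with hK1
  set K2 := 256 / C ^ 2 * Real.exp (4 * Real.exp 1 * C ^ 2) with hK2
  have hK10 : 0 < K1 := by positivity
  have hK20 : 0 < K2 := by positivity
  have hD := bexp_diag_pow_le_pow h0 h1 hp ht hC hn₂ (q := m + 1) (by omega)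
    (by push_cast; nlinarith) i
  have hz : ∀ k ∈ K, bexp ρ (fun a =>
      (((ctrMat ρ a * (ctrMat ρ a).transpose) i k) ^ 2) ^ (m + 1)) ≤ 2 * (K2 * x) ^ (m + 1) :=
    fun k hk => bexp_offDiag_pow_le_pow h0 h1 hp ht hC hn₁ hn₂ (q := m + 1) (by omega) hL
      (by push_cast; exact hLq) (by push_cast; exact hqn) hx (fun h => hi (h ▸ hk))
  have hrow := bexp_row_pow_le h0 h1 (by positivity : 0 ≤ 2 * p) ht hi m
  have hsum : ∑ k ∈ K, bexp ρ (fun a =>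
      (((ctrMat ρ a * (ctrMat ρ a).transpose) i k) ^ 2) ^ (m + 1))
      ≤ n₁ * (2 * (K2 * x) ^ (m + 1)) := by
    calc _ ≤ ∑ _k ∈ K, 2 * (K2 * x) ^ (m + 1) := Finset.sum_le_sum hz
      _ = K.card * (2 * (K2 * x) ^ (m + 1)) := by simp
      _ ≤ _ := by gcongr
  have hfirst : n₁ * ((2 * (Real.exp 1 * K.card * (2 * p))) ^ (m + 1) *
      (n₂ * p * K1) ^ (m + 1)) ≤ (4 * Real.exp 1 ^ 2 * K1 * (n₁ * n₂ * p ^ 2)) ^ (m + 1) := by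
    calc _ ≤ Real.exp 1 ^ (m + 1) * ((2 * (Real.exp 1 * n₁ * (2 * p))) ^ (m + 1) *
          (n₂ * p * K1) ^ (m + 1)) := by gcongr
      _ = _ := by rw [← mul_pow, ← mul_pow]; congr 1; ring
  -- Both factors n₁ are paid for by e^(m+1), and (m+1)x ≤ 3Lx = 3n₁n₂p²: the factor (m+1)ᵐ from
  -- Rosenthal is offset by the 1/L in x.
  have hsecond : n₁ * (2 * (m + 1 : ℝ) ^ m * (n₁ * (2 * (K2 * x) ^ (m + 1)))) ≤
      (12 * Real.exp 1 ^ 2 * K2 * (n₁ * n₂ * p ^ 2)) ^ (m + 1) := by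
    have hm1 : (1 : ℝ) ≤ m + 1 := by
      have : (0 : ℝ) ≤ m := Nat.cast_nonneg m
      linarith
    have h4 : (4 : ℝ) ≤ 4 ^ (m + 1) := le_self_pow₀ (by norm_num) (by omega)
    have hmm : (m + 1 : ℝ) ^ m ≤ (m + 1 : ℝ) ^ (m + 1) := pow_le_pow_right₀ hm1 (by omega)
    have hLx : L * x = n₁ * n₂ * p ^ 2 := by rw [hxdef]; field_simp
    calc _ = 4 * (m + 1 : ℝ) ^ m * (n₁ * n₁) * (K2 * x) ^ (m + 1) := by ring
      _ ≤ 4 ^ (m + 1) * (m + 1 : ℝ) ^ (m + 1) *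
          (Real.exp 1 ^ (m + 1) * Real.exp 1 ^ (m + 1)) * (K2 * x) ^ (m + 1) := by gcongr
      _ = (4 * Real.exp 1 ^ 2 * K2 * ((m + 1) * x)) ^ (m + 1) := by
          rw [← mul_pow, ← mul_pow, ← mul_pow, ← mul_pow]; congr 1; ring
      _ ≤ (4 * Real.exp 1 ^ 2 * K2 * (3 * L * x)) ^ (m + 1) := by gcongr
      _ = _ := by rw [mul_assoc 3, hLx]; congr 1; ring
  calc _ ≤ n₁ * ((2 * (Real.exp 1 * K.card * (2 * p))) ^ (m + 1) * (n₂ * p * K1) ^ (m + 1)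
        + 2 * (m + 1 : ℝ) ^ m * (n₁ * (2 * (K2 * x) ^ (m + 1)))) := by
        gcongr
        refine hrow.trans ?_
        gcongr
    _ ≤ (4 * Real.exp 1 ^ 2 * K1 * (n₁ * n₂ * p ^ 2)) ^ (m + 1) +
        (12 * Real.exp 1 ^ 2 * K2 * (n₁ * n₂ * p ^ 2)) ^ (m + 1) := by
        rw [mul_add]
        exact add_le_add hfirst hsecond
    _ ≤ (4 * Real.exp 1 ^ 2 * K1 * (n₁ * n₂ * p ^ 2) +
        12 * Real.exp 1 ^ 2 * K2 * (n₁ * n₂ * p ^ 2)) ^ (m + 1) :=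
        pow_add_pow_le (by positivity) (by positivity) (by omega)
    _ = _ := by rw [rowConst, ← hK1, ← hK2]; congr 1; ring

/-- The constant in the main bound. -/
noncomputable def mainConst (C : ℝ) : ℝ :=
  4 * (128 * Real.exp 1 ^ 2) ^ 2 + 512 * Real.exp 1 ^ 2 * (3 / C + 4) + 384 * rowConst C

lemma mainConst_pos (hC : 0 < C) : 0 < mainConst C := by
  have := rowConst_pos hC
  unfold mainConst; positivity

lemma bexp_hollow_sq_le_mainConst (h0 : ∀ i j, 0 ≤ ρ i j) (h1 : ∀ i j, ρ i j ≤ 1) (hp : 0 < p)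
    (ht : ∀ i j, ρ i j ≤ 2 * p) (hC : 0 < C) (hn₁ : 2 ≤ n₁) (hn₂ : 0 < n₂)
    (hx : C ^ 2 ≤ n₁ * n₂ * p ^ 2 / Real.log n₁) (hLp : C * Real.log n₁ ≤ n₂ * p) :
    bexp ρ (fun a => specNorm (hollow (ctrMat ρ a * (ctrMat ρ a).transpose)) ^ 2) ≤
      mainConst C * (1 + n₁ * Real.log n₁ / n₂) * n₁ * n₂ * p ^ 2 * Real.log n₁ := by
  have hnR₁ : (0 : ℝ) < n₁ := by positivity
  have hnR : (0 : ℝ) < n₂ := by exact_mod_cast hn₂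
  set L := Real.log n₁ with hLdef
  -- This is where n₁ ≥ 2 enters: log 2 > 1/2 gives both ⌈L⌉ ≤ L + 1 ≤ 3L and 1 ≤ 4L².
  have hL2 : 1 / 2 < L := by
    have h := Real.log_le_log (by norm_num) (by exact_mod_cast hn₁ : (2 : ℝ) ≤ n₁)
    have := Real.log_two_gt_d9
    linarith
  have hL : 0 < L := by linarith
  have hexpL : Real.exp L = n₁ := Real.exp_log hnR₁
  obtain ⟨m, hm⟩ : ∃ m, ⌈L⌉₊ = m + 1 := Nat.exists_eq_add_one.2 (Nat.ceil_pos.2 hL)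
  have hLq : L ≤ m + 1 := by
    have := Nat.le_ceil L
    rw [hm] at this
    exact_mod_cast this
  have hqL1 : (m + 1 : ℝ) ≤ L + 1 := by
    have := (Nat.ceil_lt_add_one hL.le).le
    rw [hm] at this
    exact_mod_cast this
  have hqL : (m + 1 : ℝ) ≤ 3 * L := by linarith
  have hqn : Real.exp (m + 1) ≤ Real.exp 1 * n₁ := by
    rw [← hexpL, ← Real.exp_add]
    exact Real.exp_le_exp.2 (by linarith)
  have hn : (n₁ : ℝ) ≤ Real.exp 1 ^ (m + 1) := by
    rw [← Real.exp_nat_mul, ← hexpL]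
    exact Real.exp_le_exp.2 (by push_cast; linarith)
  have hR := rowConst_pos hC
  have he1 : Real.exp 1 - 1 ≤ 2 := by linarith [Real.exp_one_lt_d9]
  have he0 : 0 ≤ Real.exp 1 - 1 := by linarith [Real.add_one_le_exp 1]
  -- Chosen so that the union bound over the n₁ diagonal entries contributes exactly 1.
  set τ := L + n₂ * (2 * p * (Real.exp 1 - 1)) with hτ
  have hτ0 : 0 ≤ τ := by positivity
  have key := bexp_hollow_sq_le h0 h1 (by positivity : 0 ≤ 2 * p) ht m
    (B := rowConst C * (n₁ * n₂ * p ^ 2)) (by positivity) hτ0 hn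
    (bexp_row_pow_le_pow h0 h1 hp ht hC (by omega) hn₂ m hL hLq hqL hqn hn hx hLp)
  have hτ1 : τ + n₁ * (Real.exp (-τ) *
      Real.exp (Fintype.card (Fin n₂) * (2 * p * (Real.exp 1 - 1)))) ≤ (3 / C + 4) * (n₂ * p) := by
    have e : n₁ * (Real.exp (-τ) *
        Real.exp (Fintype.card (Fin n₂) * (2 * p * (Real.exp 1 - 1)))) = 1 := by
      rw [← Real.exp_add, ← hexpL, ← Real.exp_add, Fintype.card_fin, hτ]
      simp
    rw [e, hτ]
    have h3 : L + 1 ≤ 3 / C * (n₂ * p) := by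
      calc L + 1 ≤ 3 / C * (C * L) := by field_simp; linarith
        _ ≤ _ := by gcongr
    have h4 : n₂ * (2 * p * (Real.exp 1 - 1)) ≤ 4 * (n₂ * p) := by
      calc _ ≤ n₂ * (2 * p * 2) := by gcongr
        _ = _ := by ring
    linarith
  have e1 : mainConst C * (1 + n₁ * L / n₂) * n₁ * n₂ * p ^ 2 * L
      = mainConst C * (n₁ * n₂ * p ^ 2 * L) + mainConst C * (n₁ ^ 2 * p ^ 2 * L ^ 2) := by
    field_simp
  rw [e1]
  have hU : 0 ≤ n₁ * n₂ * p ^ 2 * L := by positivity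
  have hV : 0 ≤ n₁ ^ 2 * p ^ 2 * L ^ 2 := by positivity
  -- The square (n₁p)² from Young's inequality is the source of the n₁ log n₁ / n₂ term; a factor L²
  -- is given away here.
  have b1 : (64 * Real.exp 1 ^ 2 * n₁ * (2 * p)) ^ 2 ≤
      4 * (128 * Real.exp 1 ^ 2) ^ 2 * (n₁ ^ 2 * p ^ 2 * L ^ 2) := by
    have hLL : 1 ≤ 4 * L ^ 2 := by nlinarith
    calc _ = (128 * Real.exp 1 ^ 2) ^ 2 * (n₁ ^ 2 * p ^ 2) * 1 := by ring
      _ ≤ (128 * Real.exp 1 ^ 2) ^ 2 * (n₁ ^ 2 * p ^ 2) * (4 * L ^ 2) := by gcongr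
      _ = _ := by ring
  have b2 : 128 * Real.exp 1 ^ 2 * n₁ * (2 * p) * (τ + n₁ * (Real.exp (-τ) *
      Real.exp (Fintype.card (Fin n₂) * (2 * p * (Real.exp 1 - 1))))) ≤
      512 * Real.exp 1 ^ 2 * (3 / C + 4) * (n₁ * n₂ * p ^ 2 * L) := by
    calc _ ≤ 128 * Real.exp 1 ^ 2 * n₁ * (2 * p) * ((3 / C + 4) * (n₂ * p)) := by gcongr
      _ = 256 * Real.exp 1 ^ 2 * (3 / C + 4) * (n₁ * n₂ * p ^ 2) * 1 := by ring
      _ ≤ 256 * Real.exp 1 ^ 2 * (3 / C + 4) * (n₁ * n₂ * p ^ 2) * (2 * L) := by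
          gcongr
          linarith
      _ = _ := by ring
  have b3 : 128 * (m + 1) * (rowConst C * (n₁ * n₂ * p ^ 2)) ≤
      384 * rowConst C * (n₁ * n₂ * p ^ 2 * L) := by
    calc _ ≤ 128 * (3 * L) * (rowConst C * (n₁ * n₂ * p ^ 2)) := by gcongr
      _ = _ := by ring
  have c1 : 512 * Real.exp 1 ^ 2 * (3 / C + 4) + 384 * rowConst C ≤ mainConst C := by
    unfold mainConst
    have : 0 ≤ 4 * (128 * Real.exp 1 ^ 2) ^ 2 := by positivity
    linarith
  have c2 : 4 * (128 * Real.exp 1 ^ 2) ^ 2 ≤ mainConst C := by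
    unfold mainConst
    have : 0 ≤ 512 * Real.exp 1 ^ 2 * (3 / C + 4) := by positivity
    linarith
  have d1 := mul_le_mul_of_nonneg_right c1 hU
  have d2 := mul_le_mul_of_nonneg_right c2 hV
  linarith

end Constants

end BSBM

theorem proposition1 (C : ℝ) (hC : 0 < C) :
    ∃ c : ℝ, 0 < c ∧
      ∀ (n₁ n₂ : ℕ) (δ p : ℝ) (η₁ : Fin n₁ → ℤˣ) (η₂ : Fin n₂ → ℤˣ)
        (Ω : Type*) [MeasurableSpace Ω] (μ : Measure Ω) [IsProbabilityMeasure μ]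
        (A : Ω → Matrix (Fin n₁) (Fin n₂) ℝ),
        2 ≤ n₁ → 2 ≤ n₂ → δ ∈ Set.Ioo (0 : ℝ) 2 → p ∈ Set.Ioo (0 : ℝ) (1 / 2) →
        BSBM.IsBSBM μ δ p η₁ η₂ A →
        C * max (Real.sqrt (Real.log (n₁ : ℝ) / ((n₁ : ℝ) * (n₂ : ℝ))))
          (Real.log (n₁ : ℝ) / (n₂ : ℝ)) ≤ p →
        Integrable (fun ω => BSBM.specNorm
            (BSBM.hollow (BSBM.noise μ A ω * (BSBM.noise μ A ω).transpose)) ^ 2) μ ∧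
          ∫ ω, BSBM.specNorm
              (BSBM.hollow (BSBM.noise μ A ω * (BSBM.noise μ A ω).transpose)) ^ 2 ∂μ ≤
            c * (1 + (n₁ : ℝ) * Real.log (n₁ : ℝ) / (n₂ : ℝ)) * (n₁ : ℝ) * (n₂ : ℝ) * p ^ 2 *
              Real.log (n₁ : ℝ) := by
  refine ⟨BSBM.mainConst C, BSBM.mainConst_pos hC, ?_⟩
  intro n₁ n₂ δ p η₁ η₂ Ω _ μ _ A hn₁ hn₂ hδ hp hA hpC
  have hnR₁ : (0 : ℝ) < n₁ := by positivity
  have hnR : (0 : ℝ) < n₂ := by positivity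
  have hL : 0 < Real.log n₁ := Real.log_pos (by exact_mod_cast hn₁)
  obtain ⟨hint, hval⟩ := hA.integral_noise (BSBM.continuous_specNorm_hollow_sq (n₁ := n₁) (n₂ := n₂))
  refine ⟨hint, ?_⟩
  rw [hval]
  have hsq : C * Real.sqrt (Real.log n₁ / (n₁ * n₂)) ≤ p :=
    (mul_le_mul_of_nonneg_left (le_max_left _ _) hC.le).trans hpC
  have hlin : C * (Real.log n₁ / n₂) ≤ p :=
    (mul_le_mul_of_nonneg_left (le_max_right _ _) hC.le).trans hpC
  refine BSBM.bexp_hollow_sq_le_mainConst (fun i j => BSBM.edgeProb_nonneg hδ hp.1.le _ _)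
    (fun i j => (BSBM.edgeProb_le hδ hp.1.le _ _).trans (by linarith [hp.2])) hp.1
    (fun i j => BSBM.edgeProb_le hδ hp.1.le _ _) hC hn₁ (by omega) ?_ ?_
  -- The square-root half of the hypothesis, squared, is C² ≤ n₁n₂p²/L; the other half is C L ≤ n₂p.
  · have h := pow_le_pow_left₀ (by positivity) hsq 2
    rw [mul_pow, Real.sq_sqrt (by positivity), ← mul_div_assoc, div_le_iff₀ (by positivity)] at h
    rw [le_div_iff₀ hL]
    linarith
  · rw [← mul_div_assoc, div_le_iff₀ hnR] at hlin
    linarith
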